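/- Let $m\ge 3$, $\eta=\mathrm{diag}(1,-1,\dots,-1)$ of signature $(1,m-1)$, and $\Sigma=\begin{pmatrix}0&0&-1\\0&\eta&0\\-1&0&0\end{pmatrix}$ in $(1+m+1)$-block form; for a row $r$ put $r^t=(r\eta^{-1})^T$. Let $\mathfrak g=\{X: X^T\Sigma+\Sigma X=0\}$ and $$k(r)=\begin{pmatrix}1&r&\tfrac12 rr^t\\0&\mathbf 1&r^t\\0&0&1\end{pmatrix},\qquad K_1=\{k(r)\},\qquad SO=\{\mathrm{diag}(1,S,1): S\in SO(1,m-1)\},$$ $W=\{\mathrm{diag}(z,\mathbf 1,z^{-1}): z>0\}$, and $H=W\cdot SO\cdot K_1$. Let $U$ be an open set with coordinates $x^\mu$ (an open subset of $\mathbb R^m$), and for a set $K$ of matrices let $\mathcal K=\{\gamma:U\to K \text{ smooth}\}$. All forms are smooth, products of forms are wedge products, matrix-valued forms are multiplied by the matrix product of their values, and $\Omega=\tfrac12\Omega_{\mu\sigma}dx^\mu\wedge dx^\sigma$ for a 2-form. A conformal Cartan connection on $U$ is a $\mathfrak g$-valued 1-form $$\varpi=\begin{pmatrix}a&\alpha&0\\\theta&A&\alpha^t\\0&\theta^T\eta&-a\end{pmatrix},\qquad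 \theta=e\cdot dx,\quad e(x)\in GL_m(\mathbb R);$$ its curvature is $\Omega=d\varpi+\varpi^2$, with $(2,1)$ block $\Theta$ and $(2,2)$ block $F$. Write $\varpi^u=u^{-1}\varpi u+u^{-1}du$ and $\Omega^u=u^{-1}\Omega u$. Put $q=a\cdot e^{-1}$, i.e. $q_b=a_\mu(e^{-1})^\mu{}_b$, and $$u_1=k(q),\qquad u_0=\mathrm{diag}(1,e,1),\qquad u=u_1u_0.$$ These fields are built from $\varpi$, and for a gauge transformation $\gamma$ the field built in the same way from $\varpi^\gamma$ is denoted $u_1^\gamma$, $u_0^\gamma$, $u^\gamma$. Then, for every conformal Cartan connection $\varpi$ on $U$: 1. $SO\cdot K_1$ is a subgroup of $H$, and $\varpi^\gamma$ is a conformal Cartan connection for every $\gamma\in\mathcal{SO}\,\mathcal K_1$ (the smooth maps $U\to SO\cdot K_1$). The field $u_1$ is smooth and $K_1$-valued, $u_0$ is smooth and invertible, $u_1^{\gamma_1}=\gamma_1^{-1}u_1$ and $u_0^{\gamma_1}=u_0$ for $\gamma_1\in\mathcal K_1$, and $u_1^S=S^{-1}u_1S$ and $u_0^S=S^{-1}u_0$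 for $S\in\mathcal{SO}$. The product $u$ is a dressing field for $\mathcal{SO}\,\mathcal K_1$: it is smooth, invertible, and $u^\gamma=\gamma^{-1}u$ for all $\gamma\in\mathcal{SO}\,\mathcal K_1$. 2. The fields $\varpi_0=\varpi^u=(\varpi^{u_1})^{u_0}$ and $\Omega_0=\Omega^u=(\Omega^{u_1})^{u_0}=d\varpi_0+\varpi_0^2$ are $\mathcal{SO}\,\mathcal K_1$-invariant. 3. Let $\alpha_1$ and $A_1$ be the $(1,2)$ and $(2,2)$ blocks of $\varpi_1=\varpi^{u_1}$, and set $P=\alpha_1e$, $\Gamma=e^{-1}A_1e+e^{-1}de$, $g=e^T\eta e$. Then $$\varpi_0=\begin{pmatrix}0&P&0\\dx&\Gamma&g^{-1}P^T\\0&dx^Tg&0\end{pmatrix}.$$ Here $g$ is a smooth nondegenerate metric, $P$ and $\Gamma$ are smooth, and $\nabla g:=dg-\Gamma^Tg-g\Gamma=0$. If $\varphi:V\to U$ is a change of coordinates (a diffeomorphism from an open subset of $\mathbb R^m$) with Jacobian $J=(\partial_\nu\varphi^\mu)$, then $\varphi^*\varpi$ is a conformal Cartan connection on $V$, and its $g$,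 $P$, $\Gamma$ are $J^T(g\circ\varphi)J$, $(\varphi^*P)J$ and $J^{-1}(\varphi^*\Gamma)J+J^{-1}dJ$. Thus $g$ and $P$ are tensors and $\Gamma$ is a linear connection. 4. With $R=d\Gamma+\Gamma^2$, $C=dP+P\wedge\Gamma$ and $\nabla g^{-1}=dg^{-1}+\Gamma g^{-1}+g^{-1}\Gamma^T$, $$\Omega_0=\begin{pmatrix}P\wedge dx&C&0\\\Gamma\wedge dx&R+dx\wedge P+g^{-1}P^T\wedge dx^Tg&\nabla g^{-1}\wedge P^T+g^{-1}C^T\\0&-dx^T\wedge(\nabla g+\Gamma^Tg)&dx^T\wedge P^T\end{pmatrix}.$$ 5. Suppose that $\varpi$ is normal: $\Theta=0$ and $F^a{}_{b,ac}=0$ (components of $F$ in the coframe $\theta$). Then $\Gamma$ is the Levi-Civita connection of $g$ (in particular $T:=\Gamma\wedge dx=0$). The coefficients of $P$ are symmetric and are those of the Schouten tensor $$P_{\mu\nu}=\frac{-1}{m-2}\Big(R_{\mu\nu}-\frac{R}{2(m-1)}g_{\mu\nu}\Big),$$ where $R_{\mu\nu}=R^\rho{}_{\mu,\rho\nu}$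 and $R$ are the Ricci tensor and scalar curvature of $g$. Moreover $$\Omega_0=\tfrac12\begin{pmatrix}0&C_{\nu,\mu\sigma}&0\\0&W^\rho{}_{\nu,\mu\sigma}&g^{\rho\lambda}C_{\lambda,\mu\sigma}\\0&0&0\end{pmatrix}dx^\mu\wedge dx^\sigma,$$ where $W$ is the Weyl tensor of $g$ and $C_{\nu,\mu\sigma}=\nabla_\mu P_{\sigma\nu}-\nabla_\sigma P_{\mu\nu}$ is its Cotton tensor, and the Ricci contraction $W^\rho{}_{\nu,\rho\sigma}$ of the $(2,2)$ block vanishes. -/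

import Mathlib

open scoped ContDiff

noncomputable section

namespace ConformalCartan

/-! ### Local calculus on an open set of coordinate space -/

/-- The space of coordinates `x = (x^μ)`. -/
abbrev Space (m : ℕ) := Fin m → ℝ

/-- Matrix-valued functions of the coordinates. -/
abbrev ZeroForm (m : ℕ) (ι κ : Type) := Space m → Matrix ι κ ℝ

/-- Matrix-valued 1-forms `B = B_μ dx^μ`, given by their coefficients `B x μ`. -/
abbrev OneForm (m : ℕ) (ι κ : Type) := Space m → Fin m → Matrix ι κ ℝ

/-- Matrix-valued 2-forms `Ω = ½ Ω_{μσ} dx^μ ∧ dx^σ`, given by their (antisymmetric)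
coefficients `Ω x μ σ`. -/
abbrev TwoForm (m : ℕ) (ι κ : Type) := Space m → Fin m → Fin m → Matrix ι κ ℝ

variable {m : ℕ} {ι κ l : Type}

/-- Smoothness on `U` of a matrix-valued function. -/
def Smooth₀ (U : Set (Space m)) (M : ZeroForm m ι κ) : Prop :=
  ∀ i j, ContDiffOn ℝ ∞ (fun x => M x i j) U

/-- Smoothness on `U` of a matrix-valued 1-form. -/
def Smooth₁ (U : Set (Space m)) (B : OneForm m ι κ) : Prop :=
  ∀ μ, Smooth₀ U (fun x => B x μ)

/-- The partial derivative `∂_μ` of a matrix-valued function, entry by entry. -/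
def pd (μ : Fin m) (M : ZeroForm m ι κ) (x : Space m) : Matrix ι κ ℝ :=
  Matrix.of fun i j => fderiv ℝ (fun y => M y i j) x (Pi.single μ 1)

/-- The exterior derivative of a 1-form: `(dB)_{μσ} = ∂_μ B_σ - ∂_σ B_μ`. -/
def extd (B : OneForm m ι κ) : TwoForm m ι κ := fun x μ σ =>
  pd μ (fun y => B y σ) x - pd σ (fun y => B y μ) x

/-- The wedge product of two matrix-valued 1-forms (matrix product of the values):
`(B ∧ τ)_{μσ} = B_μ τ_σ - B_σ τ_μ`. -/
def wedge [Fintype κ] (B : OneForm m ι κ) (τ : OneForm m κ l) : TwoForm m ι l :=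
  fun x μ σ => B x μ * τ x σ - B x σ * τ x μ

/-- The curvature `dB + B ∧ B`. -/
def curvature [Fintype ι] (B : OneForm m ι ι) : TwoForm m ι ι := fun x μ σ =>
  extd B x μ σ + wedge B B x μ σ

/-- `B^u = u⁻¹ B u + u⁻¹ du`: the gauge transformation of `B` by `u`, and also the dressing
of `B` by `u`. -/
def act [Fintype ι] [DecidableEq ι] (B : OneForm m ι ι) (u : ZeroForm m ι ι) :
    OneForm m ι ι := fun x μ =>
  (u x)⁻¹ * B x μ * u x + (u x)⁻¹ * pd μ u x

/-- `Ω^u = u⁻¹ Ω u`. -/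
def conj [Fintype ι] [DecidableEq ι] (Ω : TwoForm m ι ι) (u : ZeroForm m ι ι) :
    TwoForm m ι ι := fun x μ σ =>
  (u x)⁻¹ * Ω x μ σ * u x

/-- The coordinate 1-form `dx`, a column. -/
def dx : OneForm m (Fin m) Unit := fun _ μ => Matrix.of fun ρ _ => if ρ = μ then 1 else 0

/-- The transposed 1-form. -/
def formT (B : OneForm m ι κ) : OneForm m κ ι := fun x μ => (B x μ).transpose

/-! ### `(1 + m + 1)`-block matrices and the Klein geometry -/

/-- The index set of `(m + 2) × (m + 2)` matrices, split as `1 + m + 1`. -/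
abbrev Idx (m : ℕ) := Unit ⊕ (Fin m ⊕ Unit)

/-- The matrix with the given `3 × 3` blocks, listed row by row. -/
def block3
    (b11 : Matrix Unit Unit ℝ) (b12 : Matrix Unit (Fin m) ℝ) (b13 : Matrix Unit Unit ℝ)
    (b21 : Matrix (Fin m) Unit ℝ) (b22 : Matrix (Fin m) (Fin m) ℝ) (b23 : Matrix (Fin m) Unit ℝ)
    (b31 : Matrix Unit Unit ℝ) (b32 : Matrix Unit (Fin m) ℝ) (b33 : Matrix Unit Unit ℝ) :
    Matrix (Idx m) (Idx m) ℝ :=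
  Matrix.fromBlocks b11 (Matrix.fromCols b12 b13) (Matrix.fromRows b21 b31)
    (Matrix.fromBlocks b22 b23 b32 b33)

/-- Block `(1,1)`. -/
def blk11 (M : Matrix (Idx m) (Idx m) ℝ) : Matrix Unit Unit ℝ :=
  Matrix.of fun i j => M (Sum.inl i) (Sum.inl j)

/-- Block `(1,2)`. -/
def blk12 (M : Matrix (Idx m) (Idx m) ℝ) : Matrix Unit (Fin m) ℝ :=
  Matrix.of fun i j => M (Sum.inl i) (Sum.inr (Sum.inl j))

/-- Block `(2,1)`. -/
def blk21 (M : Matrix (Idx m) (Idx m) ℝ) : Matrix (Fin m) Unit ℝ :=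
  Matrix.of fun i j => M (Sum.inr (Sum.inl i)) (Sum.inl j)

/-- Block `(2,2)`. -/
def blk22 (M : Matrix (Idx m) (Idx m) ℝ) : Matrix (Fin m) (Fin m) ℝ :=
  Matrix.of fun i j => M (Sum.inr (Sum.inl i)) (Sum.inr (Sum.inl j))

/-- The Minkowski matrix `η = diag(1, -1, …, -1)` of signature `(1, m - 1)`. -/
def eta (m : ℕ) : Matrix (Fin m) (Fin m) ℝ :=
  Matrix.diagonal fun i => if (i : ℕ) = 0 then 1 else -1

/-- The `η`-transpose `r^t = (r η⁻¹)ᵀ` of a row. -/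
def rowT (r : Matrix Unit (Fin m) ℝ) : Matrix (Fin m) Unit ℝ := (r * (eta m)⁻¹).transpose

/-- The matrix `Σ` of the quadratic form of signature `(2, m)`. -/
def sigma (m : ℕ) : Matrix (Idx m) (Idx m) ℝ :=
  block3 0 0 (-1) 0 (eta m) 0 (-1) 0 0

/-- The Lie algebra `𝔤 = 𝔬(2, m)` of matrices `X` with `Xᵀ Σ + Σ X = 0`. -/
def lieG (m : ℕ) : Submodule ℝ (Matrix (Idx m) (Idx m) ℝ) :=
  skewAdjointMatricesSubmodule (sigma m)

/-- The Weyl rescaling `diag(z, 1, z⁻¹)`. -/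
def weylMatrix (z : ℝ) : Matrix (Idx m) (Idx m) ℝ :=
  block3 (Matrix.of fun _ _ => z) 0 0 0 1 0 0 0 (Matrix.of fun _ _ => z⁻¹)

/-- The block-diagonal matrix `diag(1, S, 1)`. -/
def middle (S : Matrix (Fin m) (Fin m) ℝ) : Matrix (Idx m) (Idx m) ℝ :=
  block3 1 0 0 0 S 0 0 0 1

/-- The inversion (special conformal transformation) with parameter the row `r`. -/
def inversion (r : Matrix Unit (Fin m) ℝ) : Matrix (Idx m) (Idx m) ℝ :=
  block3 1 r ((1 / 2 : ℝ) • (r * rowT r)) 0 1 (rowT r) 0 0 1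

/-- The group `W` of Weyl rescalings. -/
def groupW (m : ℕ) : Set (Matrix (Idx m) (Idx m) ℝ) :=
  {M | ∃ z : ℝ, 0 < z ∧ M = weylMatrix z}

/-- The Lorentz group `SO(1, m - 1)`, as block matrices `diag(1, S, 1)`. -/
def groupSO (m : ℕ) : Set (Matrix (Idx m) (Idx m) ℝ) :=
  {M | ∃ S : Matrix (Fin m) (Fin m) ℝ, S.transpose * eta m * S = eta m ∧ S.det = 1 ∧
    M = middle S}

/-- The group `K₁` of inversions. -/
def groupK₁ (m : ℕ) : Set (Matrix (Idx m) (Idx m) ℝ) :=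
  {M | ∃ r : Matrix Unit (Fin m) ℝ, M = inversion r}

/-- The products `SO · K₁`. -/
def groupSOK₁ (m : ℕ) : Set (Matrix (Idx m) (Idx m) ℝ) :=
  {M | ∃ S ∈ groupSO m, ∃ k ∈ groupK₁ m, M = S * k}

/-- The structure group `H = K₀ K₁`, with `K₀ = W · SO(1, m - 1)`. -/
def groupH (m : ℕ) : Set (Matrix (Idx m) (Idx m) ℝ) :=
  {M | ∃ w ∈ groupW m, ∃ S ∈ groupSO m, ∃ k ∈ groupK₁ m, M = w * S * k}

/-- A set of matrices is a group under matrix multiplication. -/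
def IsMatrixGroup [Fintype ι] [DecidableEq ι] (K : Set (Matrix ι ι ℝ)) : Prop :=
  1 ∈ K ∧ (∀ M ∈ K, ∀ N ∈ K, M * N ∈ K) ∧ ∀ M ∈ K, IsUnit M.det ∧ M⁻¹ ∈ K

/-- `γ` is an element of the gauge group `{γ : U → K}` (smooth maps). -/
def IsGauge (U : Set (Space m)) (K : Set (Matrix ι ι ℝ)) (γ : ZeroForm m ι ι) : Prop :=
  Smooth₀ U γ ∧ ∀ x ∈ U, γ x ∈ K

/-! ### Conformal Cartan connections and their dressing -/

/-- The vielbein `e`, with `θ = e · dx`, where `θ` is the `(2,1)` block of `ϖ`. -/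
def vielbein (ϖ : OneForm m (Idx m) (Idx m)) : ZeroForm m (Fin m) (Fin m) := fun x =>
  Matrix.of fun a μ => blk21 (ϖ x μ) a ()

/-- The row `(a_μ)` of coefficients of the 1-form `a`, the `(1,1)` block of `ϖ`. -/
def aRow (ϖ : OneForm m (Idx m) (Idx m)) : ZeroForm m Unit (Fin m) := fun x =>
  Matrix.of fun _ μ => blk11 (ϖ x μ) () ()

/-- A (local) conformal Cartan connection on `U`: a smooth `𝔤`-valued 1-form whose
`𝔤₋₁`-part `θ` is an isomorphism from each tangent space onto `ℝ^m`. -/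
structure IsCartanConnection (U : Set (Space m)) (ϖ : OneForm m (Idx m) (Idx m)) : Prop where
  smooth : Smooth₁ U ϖ
  mem_lieG : ∀ x ∈ U, ∀ μ, ϖ x μ ∈ lieG m
  soldering : ∀ x ∈ U, IsUnit (vielbein ϖ x).det

/-- `q = a · e⁻¹`. -/
def q (ϖ : OneForm m (Idx m) (Idx m)) : ZeroForm m Unit (Fin m) := fun x =>
  aRow ϖ x * (vielbein ϖ x)⁻¹

/-- The field `u₁`. -/
def u₁ (ϖ : OneForm m (Idx m) (Idx m)) : ZeroForm m (Idx m) (Idx m) := fun x =>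
  inversion (q ϖ x)

/-- The field `u₀ = diag(1, e, 1)`. -/
def u₀ (ϖ : OneForm m (Idx m) (Idx m)) : ZeroForm m (Idx m) (Idx m) := fun x =>
  middle (vielbein ϖ x)

/-- The product `u = u₁ u₀`. -/
def u (ϖ : OneForm m (Idx m) (Idx m)) : ZeroForm m (Idx m) (Idx m) := fun x =>
  u₁ ϖ x * u₀ ϖ x

/-- `u` (a field built from the Cartan connection) is, at `ϖ`, a dressing field on `U` for the
gauge group `{γ : U → K}`: it is smooth, invertible, and if `ϖ` is replaced by `ϖ^γ` then `u`
is replaced by `γ⁻¹ u`. -/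
def IsDressingField (U : Set (Space m)) (K : Set (Matrix (Idx m) (Idx m) ℝ))
    (u : OneForm m (Idx m) (Idx m) → ZeroForm m (Idx m) (Idx m))
    (ϖ : OneForm m (Idx m) (Idx m)) : Prop :=
  Smooth₀ U (u ϖ) ∧ (∀ x ∈ U, IsUnit (u ϖ x).det) ∧
    ∀ γ, IsGauge U K γ → ∀ x ∈ U, u (act ϖ γ) x = (γ x)⁻¹ * u ϖ x

/-- `ϖ₁ = ϖ^{u₁}`. -/
def varpi₁ (ϖ : OneForm m (Idx m) (Idx m)) : OneForm m (Idx m) (Idx m) := act ϖ (u₁ ϖ)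

/-- `A₁`, the `(2,2)` block of `ϖ₁`. -/
def A₁ (ϖ : OneForm m (Idx m) (Idx m)) : OneForm m (Fin m) (Fin m) := fun x μ =>
  blk22 (varpi₁ ϖ x μ)

/-- `α₁`, the `(1,2)` block of `ϖ₁`. -/
def alpha₁ (ϖ : OneForm m (Idx m) (Idx m)) : OneForm m Unit (Fin m) := fun x μ =>
  blk12 (varpi₁ ϖ x μ)

/-- The dressed connection `ϖ₀ = ϖ^u`. -/
def varpi₀ (ϖ : OneForm m (Idx m) (Idx m)) : OneForm m (Idx m) (Idx m) := act ϖ (u ϖ)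

/-- The dressed curvature `Ω₀ = Ω^u`, with `Ω = dϖ + ϖ ∧ ϖ`. -/
def Omega₀ (ϖ : OneForm m (Idx m) (Idx m)) : TwoForm m (Idx m) (Idx m) :=
  conj (curvature ϖ) (u ϖ)

/-- The metric `g = eᵀ η e`. -/
def metric (ϖ : OneForm m (Idx m) (Idx m)) : ZeroForm m (Fin m) (Fin m) := fun x =>
  (vielbein ϖ x).transpose * eta m * vielbein ϖ x

/-- `Γ = e⁻¹ A₁ e + e⁻¹ de`; the entry `(ρ, ν)` of `Gam ϖ x μ` is `Γ^ρ_{μν}`. -/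
def Gam (ϖ : OneForm m (Idx m) (Idx m)) : OneForm m (Fin m) (Fin m) :=
  act (A₁ ϖ) (vielbein ϖ)

/-- `P = α₁ e`; the entry `ν` of the row `Pf ϖ x μ` is `P_{μν}`. -/
def Pf (ϖ : OneForm m (Idx m) (Idx m)) : OneForm m Unit (Fin m) := fun x μ =>
  alpha₁ ϖ x μ * vielbein ϖ x

/-- `∇g = dg - Γᵀ g - g Γ`. -/
def nablaMetric (Γ : OneForm m (Fin m) (Fin m)) (g : ZeroForm m (Fin m) (Fin m)) :
    OneForm m (Fin m) (Fin m) := fun x μ =>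
  pd μ g x - (Γ x μ).transpose * g x - g x * Γ x μ

/-- `∇g⁻¹ = dg⁻¹ + Γ g⁻¹ + g⁻¹ Γᵀ`. -/
def nablaInvMetric (Γ : OneForm m (Fin m) (Fin m)) (g : ZeroForm m (Fin m) (Fin m)) :
    OneForm m (Fin m) (Fin m) := fun x μ =>
  pd μ (fun y => (g y)⁻¹) x + Γ x μ * (g x)⁻¹ + (g x)⁻¹ * (Γ x μ).transpose

/-- The Ricci contraction `R_{νσ} = R^ρ_{ν,ρσ}` of a 2-form `R^ρ_{ν,μσ}` valued in `m × m`
matrices. -/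
def ricciContraction (R : TwoForm m (Fin m) (Fin m)) : ZeroForm m (Fin m) (Fin m) := fun x =>
  Matrix.of fun ν σ => ∑ ρ, R x ρ σ ρ ν

/-- The contraction `F^a_{b,ac}`, where
`F^a_{b,cd} = F^a_{b,μσ} (e⁻¹)^μ_c (e⁻¹)^σ_d` are the components of `F` in the coframe `θ`. -/
def ricciFrame (F : TwoForm m (Fin m) (Fin m)) (e : ZeroForm m (Fin m) (Fin m)) :
    ZeroForm m (Fin m) (Fin m) := fun x =>
  Matrix.of fun b c => ∑ a, ∑ μ, ∑ σ, F x μ σ a b * (e x)⁻¹ μ a * (e x)⁻¹ σ c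

/-- Normality on `U`: the torsion `Θ` (block `(2,1)` of the curvature) vanishes, and so does the
Ricci contraction of `F` (block `(2,2)` of the curvature). -/
def IsNormal (U : Set (Space m)) (ϖ : OneForm m (Idx m) (Idx m)) : Prop :=
  (∀ x ∈ U, ∀ μ σ, blk21 (curvature ϖ x μ σ) = 0) ∧
    ∀ x ∈ U, ricciFrame (fun y μ σ => blk22 (curvature ϖ y μ σ)) (vielbein ϖ) x = 0

/-! ### Pseudo-Riemannian geometry in coordinates -/

/-- The Levi-Civita connection of `g` (Christoffel symbols),
`Γ^ρ_{μν} = ½ g^{ρλ} (∂_μ g_{λν} + ∂_ν g_{λμ} - ∂_λ g_{μν})`. -/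
def leviCivita (g : ZeroForm m (Fin m) (Fin m)) : OneForm m (Fin m) (Fin m) := fun x μ =>
  Matrix.of fun ρ ν =>
    (1 / 2 : ℝ) * ∑ l, (g x)⁻¹ ρ l * (pd μ g x l ν + pd ν g x l μ - pd l g x μ ν)

/-- The Riemann tensor `R^ρ_{ν,μσ}` of `g`. -/
def riemann (g : ZeroForm m (Fin m) (Fin m)) : TwoForm m (Fin m) (Fin m) :=
  curvature (leviCivita g)

/-- The Ricci tensor of `g`. -/
def ricci (g : ZeroForm m (Fin m) (Fin m)) : ZeroForm m (Fin m) (Fin m) :=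
  ricciContraction (riemann g)

/-- The scalar curvature of `g`. -/
def scalarCurv (g : ZeroForm m (Fin m) (Fin m)) (x : Space m) : ℝ :=
  ∑ ν, ∑ σ, (g x)⁻¹ ν σ * ricci g x ν σ

/-- The Schouten tensor of `g`, in the sign convention
`P_{μν} = -1/(m-2) (R_{μν} - R/(2(m-1)) g_{μν})`. -/
def schouten (g : ZeroForm m (Fin m) (Fin m)) : ZeroForm m (Fin m) (Fin m) := fun x =>
  Matrix.of fun μ ν =>
    -1 / ((m : ℝ) - 2) * (ricci g x μ ν - scalarCurv g x / (2 * ((m : ℝ) - 1)) * g x μ ν)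

/-- The Weyl tensor `W^ρ_{ν,μσ}` of `g`. -/
def weylTensor (g : ZeroForm m (Fin m) (Fin m)) : TwoForm m (Fin m) (Fin m) := fun x μ σ =>
  let δ : Matrix (Fin m) (Fin m) ℝ := 1
  let ricUp : Matrix (Fin m) (Fin m) ℝ := (g x)⁻¹ * ricci g x
  Matrix.of fun ρ ν => riemann g x μ σ ρ ν
    - 1 / ((m : ℝ) - 2) * (δ ρ μ * ricci g x ν σ - δ ρ σ * ricci g x ν μ
        + ricUp ρ μ * g x ν σ - ricUp ρ σ * g x ν μ)
    + scalarCurv g x / (((m : ℝ) - 1) * ((m : ℝ) - 2)) * (δ ρ μ * g x ν σ - δ ρ σ * g x ν μ)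

/-- The covariant derivative `∇_μ P_{σν}` of a covariant 2-tensor for the Levi-Civita
connection of `g`. -/
def covDeriv (g P : ZeroForm m (Fin m) (Fin m)) (x : Space m) (μ σ ν : Fin m) : ℝ :=
  pd μ P x σ ν - (∑ l, leviCivita g x μ l σ * P x l ν) - ∑ l, leviCivita g x μ l ν * P x σ l

/-- The Cotton tensor `C_{ν,μσ} = ∇_μ P_{σν} - ∇_σ P_{μν}` of `g`, as a row-valued 2-form. -/
def cotton (g : ZeroForm m (Fin m) (Fin m)) : TwoForm m Unit (Fin m) := fun x μ σ =>
  Matrix.of fun _ ν => covDeriv g (schouten g) x μ σ ν - covDeriv g (schouten g) x σ μ ν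

/-! ### Changes of coordinates -/

/-- The Jacobian matrix `J^μ_ν = ∂_ν φ^μ`. -/
def jac (φ : Space m → Space m) : ZeroForm m (Fin m) (Fin m) := fun y =>
  Matrix.of fun μ ν => fderiv ℝ (fun z => φ z μ) y (Pi.single ν 1)

/-- The pullback of a 1-form. -/
def pullback (φ : Space m → Space m) (B : OneForm m ι κ) : OneForm m ι κ := fun y ν =>
  ∑ μ, jac φ y μ ν • B (φ y) μ

/-- `φ` is a change of coordinates from `V` to `U`: a diffeomorphism of `V` onto `U`. -/
def IsCoordChange (V U : Set (Space m)) (φ : Space m → Space m) : Prop :=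
  IsOpen V ∧ Set.BijOn φ V U ∧ ContDiffOn ℝ ∞ φ V ∧ ∀ y ∈ V, IsUnit (jac φ y).det

end ConformalCartan

end

namespace ConformalCartan

/-! ### Calculus of matrix-valued functions and forms -/

section Calculus

variable {m : ℕ} {ι κ l n : Type} {U : Set (Space m)} {x : Space m}

/-! The first column of `diag(1,S,1) k(r)` is constant, so `γ⁻¹ dγ` has zero first column and the
blocks `a`, `θ` transform without derivatives of `γ` (`blk_act`): `e ↦ S⁻¹ e` and `a ↦ a - r S⁻¹ e`.
Hence `q ↦ q S - r` (`q_act`). Since `k` is additive in `r` and `k(r) diag(1,S,1) = diag(1,S,1) k(r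
S)` for Lorentz `S`, the product `u` goes to `γ⁻¹ u` (`u_act`). As `ϖ ↦ ϖ^u` is a right action
(`act_mul`), `ϖ^u` does not change; the curvature is covariant (`curvature_act`), so `Ω₀` is the
curvature of `ϖ₀` and is invariant too.

The field `u₁` is itself a `K₁`-valued gauge transformation, with parameter `r = q`, and this choice
kills `a`. So `ϖ₁` is `𝔤`-valued with `a = 0`, and dressing it by `e` produces `dx`, `Γ`, `P`, `g`.
That `A₁` is `η`-skew amounts to `∇g = 0`. A change of coordinates multiplies `a` and `e` by `J` on
the right and leaves `q` alone, so only the last step changes, from `e` to `e J`; this gives the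
transformation laws of `g`, `P`, `Γ`. The formula for `Ω₀` is block multiplication.

In the normal case, zero torsion means that `Γ` is symmetric, hence Levi-Civita. It also makes `Ω`
block triangular, so `F` is merely conjugated by `e`, and its Ricci condition reads `R_{νσ} + (m-2)
P_{σν} + (tr P) g_{σν} = 0`. The Ricci tensor is symmetric, by the first Bianchi identity and
tracelessness of the curvature; since `m ≥ 3` the equation can be solved, and `P` is the Schouten
tensor. Substitution gives the Weyl and Cotton tensors. -/

theorem Smooth₀.differentiableAt {M : ZeroForm m ι κ} (hM : Smooth₀ U M) (hU : IsOpen U)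
    (hx : x ∈ U) (i : ι) (j : κ) : DifferentiableAt ℝ (fun y => M y i j) x :=
  ((hM i j).contDiffAt (hU.mem_nhds hx)).differentiableAt (by simp)

theorem smooth₀_const (A : Matrix ι κ ℝ) : Smooth₀ U (fun _ : Space m => A) :=
  fun _ _ => contDiffOn_const

theorem Smooth₀.add {M N : ZeroForm m ι κ} (hM : Smooth₀ U M) (hN : Smooth₀ U N) :
    Smooth₀ U (fun x => M x + N x) := fun i j => (hM i j).add (hN i j)

theorem Smooth₀.const_smul {M : ZeroForm m ι κ} (hM : Smooth₀ U M) (c : ℝ) :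
    Smooth₀ U (fun x => c • M x) := fun i j => contDiffOn_const.mul (hM i j)

theorem Smooth₀.smul {f : Space m → ℝ} {M : ZeroForm m ι κ} (hf : ContDiffOn ℝ ∞ f U)
    (hM : Smooth₀ U M) : Smooth₀ U (fun x => f x • M x) := fun i j => hf.mul (hM i j)

theorem Smooth₀.sum {s : Finset n} {M : n → ZeroForm m ι κ} (hM : ∀ k ∈ s, Smooth₀ U (M k)) :
    Smooth₀ U (fun x => ∑ k ∈ s, M k x) := fun i j => by
  simp only [Matrix.sum_apply]
  exact ContDiffOn.sum fun k hk => hM k hk i j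

theorem Smooth₀.mul [Fintype κ] {M : ZeroForm m ι κ} {N : ZeroForm m κ l} (hM : Smooth₀ U M)
    (hN : Smooth₀ U N) : Smooth₀ U (fun x => M x * N x) := fun i j => by
  simp only [Matrix.mul_apply]
  exact ContDiffOn.sum fun k _ => (hM i k).mul (hN k j)

theorem Smooth₀.transpose {M : ZeroForm m ι κ} (hM : Smooth₀ U M) :
    Smooth₀ U (fun x => (M x).transpose) := fun i j => hM j i

theorem Smooth₀.det [Fintype ι] [DecidableEq ι] {M : ZeroForm m ι ι} (hM : Smooth₀ U M) :
    ContDiffOn ℝ ∞ (fun x => (M x).det) U := by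
  simp only [Matrix.det_apply']
  exact ContDiffOn.sum fun k _ => contDiffOn_const.mul (contDiffOn_prod fun i _ => hM _ i)

theorem Smooth₀.inv [Fintype ι] [DecidableEq ι] {M : ZeroForm m ι ι} (hM : Smooth₀ U M)
    (h : ∀ x ∈ U, IsUnit (M x).det) : Smooth₀ U (fun x => (M x)⁻¹) := fun i j => by
  simp only [Matrix.inv_def, Matrix.smul_apply, Ring.inverse_eq_inv', Matrix.adjugate_apply,
    smul_eq_mul]
  -- Cramer's rule: the `(i, j)` entry is `det⁻¹` times the determinant of `M` with row `j` replaced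
  -- by a constant row.
  refine (hM.det.inv fun x hx => (h x hx).ne_zero).mul (Smooth₀.det fun a b => ?_)
  by_cases ha : a = j
  · subst ha; simpa using contDiffOn_const
  · simpa [Matrix.updateRow_ne ha] using hM a b

theorem Smooth₀.pd {M : ZeroForm m ι κ} (hM : Smooth₀ U M) (hU : IsOpen U) (μ : Fin m) :
    Smooth₀ U (pd μ M) := fun i j =>
  ((hM i j).fderiv_of_isOpen hU (m := ∞) (by simp)).clm_apply contDiffOn_const

/-- Identities are known only on `U`; openness makes them hold near `x`, so they can be
differentiated. -/
theorem pd_congr {M N : ZeroForm m ι κ} (hU : IsOpen U) (hx : x ∈ U) (h : ∀ y ∈ U, M y = N y)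
    (μ : Fin m) : pd μ M x = pd μ N x := by
  ext i j
  simp only [pd, Matrix.of_apply]
  rw [Filter.EventuallyEq.fderiv_eq]
  filter_upwards [hU.mem_nhds hx] with y hy
  rw [h y hy]

theorem pd_const (A : Matrix ι κ ℝ) (μ : Fin m) : pd μ (fun _ => A) x = 0 := by
  ext i j; simp [pd]

theorem pd_apply (M : ZeroForm m ι κ) (μ : Fin m) (i : ι) (j : κ) :
    pd μ M x i j = fderiv ℝ (fun y => M y i j) x (Pi.single μ 1) := rfl

theorem pd_transpose (M : ZeroForm m ι κ) (μ : Fin m) :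
    pd μ (fun y => (M y).transpose) x = (pd μ M x).transpose := rfl

theorem pd_neg (M : ZeroForm m ι κ) (μ : Fin m) :
    pd μ (fun y => -M y) x = -pd μ M x := by
  ext i j
  simp [pd_apply]

theorem pd_add {M N : ZeroForm m ι κ} (hU : IsOpen U) (hx : x ∈ U) (hM : Smooth₀ U M)
    (hN : Smooth₀ U N) (μ : Fin m) : pd μ (fun y => M y + N y) x = pd μ M x + pd μ N x := by
  ext i j
  simp only [pd_apply, Matrix.add_apply]
  rw [fderiv_fun_add (hM.differentiableAt hU hx i j) (hN.differentiableAt hU hx i j)]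
  rfl

theorem pd_mul [Fintype κ] {M : ZeroForm m ι κ} {N : ZeroForm m κ l} (hU : IsOpen U) (hx : x ∈ U)
    (hM : Smooth₀ U M) (hN : Smooth₀ U N) (μ : Fin m) :
    pd μ (fun y => M y * N y) x = pd μ M x * N x + M x * pd μ N x := by
  ext i j
  have h : HasFDerivAt (fun y => (M y * N y) i j)
      (∑ k, (M x i k • fderiv ℝ (fun y => N y k j) x + N x k j • fderiv ℝ (fun y => M y i k) x))
      x := by
    simp only [Matrix.mul_apply]
    exact HasFDerivAt.fun_sum fun k _ => (hM.differentiableAt hU hx i k).hasFDerivAt.mul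
      (hN.differentiableAt hU hx k j).hasFDerivAt
  rw [pd_apply, h.fderiv]
  simp only [_root_.sum_apply, _root_.add_apply,
    _root_.smul_apply, smul_eq_mul, Matrix.add_apply, Matrix.mul_apply, pd_apply,
    ← Finset.sum_add_distrib]
  exact Finset.sum_congr rfl fun k _ => by ring

theorem pd_inv [Fintype ι] [DecidableEq ι] {M : ZeroForm m ι ι} (hU : IsOpen U) (hx : x ∈ U)
    (hM : Smooth₀ U M) (h : ∀ x ∈ U, IsUnit (M x).det) (μ : Fin m) :
    pd μ (fun y => (M y)⁻¹) x = -((M x)⁻¹ * pd μ M x * (M x)⁻¹) := by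
  have h1 := pd_mul hU hx hM (hM.inv h) μ
  rw [pd_congr hU hx (N := fun _ => 1) (fun y hy => Matrix.mul_nonsing_inv _ (h y hy)),
    pd_const] at h1
  have h2 : (M x)⁻¹ * (M x * pd μ (fun y => (M y)⁻¹) x) = -((M x)⁻¹ * (pd μ M x * (M x)⁻¹)) := by
    rw [← Matrix.mul_neg, eq_neg_of_add_eq_zero_right h1.symm]
  rwa [Matrix.nonsing_inv_mul_cancel_left _ _ (h x hx), ← Matrix.mul_assoc] at h2

theorem pd_comm {M : ZeroForm m ι κ} (hU : IsOpen U) (hx : x ∈ U) (hM : Smooth₀ U M)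
    (μ σ : Fin m) : pd μ (pd σ M) x = pd σ (pd μ M) x := by
  ext i j
  have hc := (hM i j).contDiffAt (hU.mem_nhds hx)
  have hs : IsSymmSndFDerivAt ℝ (fun y => M y i j) x :=
    hc.isSymmSndFDerivAt (by
      simpa using WithTop.coe_le_coe.2 (le_top : (2 : ℕ∞) ≤ ⊤))
  have hd : DifferentiableAt ℝ (fderiv ℝ (fun y => M y i j)) x :=
    (hc.fderiv_right (m := ∞) (by simp)).differentiableAt (by simp)
  -- Both iterated partials are the second Fréchet derivative at basis vectors, which is symmetric.
  have key : ∀ a b : Fin m, pd a (pd b M) x i j =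
      fderiv ℝ (fderiv ℝ (fun y => M y i j)) x (Pi.single a 1) (Pi.single b 1) := by
    intro a b
    simp only [pd_apply]
    rw [fderiv_clm_apply hd (differentiableAt_const _)]
    simp
  rw [key, key, hs]

theorem Smooth₁.act [Fintype ι] [DecidableEq ι] {B : OneForm m ι ι} {u : ZeroForm m ι ι}
    (hU : IsOpen U) (hB : Smooth₁ U B) (hu : Smooth₀ U u) (h : ∀ x ∈ U, IsUnit (u x).det) :
    Smooth₁ U (act B u) := fun μ =>
  (((hu.inv h).mul (hB μ)).mul hu).add ((hu.inv h).mul (hu.pd hU μ))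

theorem act_congr [Fintype ι] [DecidableEq ι] {B B' : OneForm m ι ι} {u v : ZeroForm m ι ι}
    (hU : IsOpen U) (hx : x ∈ U) (hB : ∀ μ, B x μ = B' x μ) (h : ∀ y ∈ U, u y = v y)
    (μ : Fin m) : act B u x μ = act B' v x μ := by
  simp only [act, hB, h x hx, pd_congr hU hx h]

/-- The action is a right action. This serves both the invariance of `ϖ^u` and dressing in two
steps. -/
theorem act_mul [Fintype ι] [DecidableEq ι] {B : OneForm m ι ι} {u v : ZeroForm m ι ι}
    (hU : IsOpen U) (hx : x ∈ U) (hu : Smooth₀ U u) (hv : Smooth₀ U v)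
    (h : IsUnit (u x).det) (μ : Fin m) :
    act B (fun y => u y * v y) x μ = act (act B u) v x μ := by
  simp only [act, pd_mul hU hx hu hv, Matrix.mul_inv_rev, Matrix.mul_add, Matrix.add_mul,
    Matrix.mul_assoc, Matrix.nonsing_inv_mul_cancel_left _ _ h]
  abel

theorem conj_mul [Fintype ι] [DecidableEq ι] (Ω : TwoForm m ι ι) (u v : ZeroForm m ι ι)
    (μ σ : Fin m) : conj Ω (fun y => u y * v y) x μ σ = conj (conj Ω u) v x μ σ := by
  simp only [conj, Matrix.mul_inv_rev, Matrix.mul_assoc]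

theorem extd_congr {B B' : OneForm m ι κ} (hU : IsOpen U) (hx : x ∈ U)
    (h : ∀ y ∈ U, ∀ μ, B y μ = B' y μ) (μ σ : Fin m) : extd B x μ σ = extd B' x μ σ := by
  simp only [extd]
  rw [pd_congr hU hx (fun y hy => h y hy σ), pd_congr hU hx (fun y hy => h y hy μ)]

theorem curvature_congr [Fintype ι] {B B' : OneForm m ι ι} (hU : IsOpen U) (hx : x ∈ U)
    (h : ∀ y ∈ U, ∀ μ, B y μ = B' y μ) (μ σ : Fin m) :
    curvature B x μ σ = curvature B' x μ σ := by
  simp only [curvature, wedge, extd_congr hU hx h, h x hx]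

/-- The curvature is gauge covariant. -/
theorem curvature_act [Fintype ι] [DecidableEq ι] {B : OneForm m ι ι} {u : ZeroForm m ι ι}
    (hU : IsOpen U) (hx : x ∈ U) (hB : Smooth₁ U B) (hu : Smooth₀ U u)
    (h : ∀ x ∈ U, IsUnit (u x).det) (μ σ : Fin m) :
    curvature (act B u) x μ σ = conj (curvature B) u x μ σ := by
  have hv := hu.inv h
  have hpd : ∀ μ σ, pd μ (fun y => act B u y σ) x =
      -((u x)⁻¹ * pd μ u x * (u x)⁻¹) * B x σ * u x + (u x)⁻¹ * pd μ (fun y => B y σ) x * u x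
        + (u x)⁻¹ * B x σ * pd μ u x - (u x)⁻¹ * pd μ u x * (u x)⁻¹ * pd σ u x
        + (u x)⁻¹ * pd μ (pd σ u) x := by
    intro μ σ
    simp only [act]
    rw [pd_add hU hx ((hv.mul (hB σ)).mul hu) (hv.mul (hu.pd hU σ)),
      pd_mul hU hx (hv.mul (hB σ)) hu, pd_mul hU hx hv (hB σ), pd_mul hU hx hv (hu.pd hU σ),
      pd_inv hU hx hu h]
    noncomm_ring
  simp only [curvature, extd, wedge, conj]
  -- Second derivatives of `u` cancel on antisymmetrising; the quadratic terms in `du` cancel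
  -- against those of the wedge.
  rw [hpd, hpd, pd_comm hU hx hu σ μ]
  simp only [act, Matrix.mul_add, Matrix.add_mul, Matrix.mul_sub, Matrix.sub_mul, Matrix.neg_mul,
    Matrix.mul_assoc, Matrix.mul_nonsing_inv_cancel_left _ _ (h x hx)]
  abel

/-- The chain rule in coordinates. -/
theorem pd_comp {V : Set (Space m)} {φ : Space m → Space m} {M : ZeroForm m ι κ} {y : Space m}
    (hU : IsOpen U) (hV : IsOpen V) (hφ : ContDiffOn ℝ ∞ φ V) (hmap : Set.MapsTo φ V U)
    (hM : Smooth₀ U M) (hy : y ∈ V) (ν : Fin m) :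
    pd ν (fun z => M (φ z)) y = ∑ μ, jac φ y μ ν • pd μ M (φ y) := by
  have hd : DifferentiableAt ℝ φ y := (hφ.contDiffAt (hV.mem_nhds hy)).differentiableAt (by simp)
  ext i j
  simp only [Matrix.sum_apply, Matrix.smul_apply, pd_apply, smul_eq_mul]
  have h1 := fderiv_comp y (hM.differentiableAt hU (hmap hy) i j) hd
  simp only [Function.comp_def] at h1
  rw [h1, ContinuousLinearMap.comp_apply]
  -- Expanding `∂_ν φ` in the standard basis lets linearity produce the sum over `μ`.
  conv_lhs => rw [pi_eq_sum_univ' (fderiv ℝ φ y (Pi.single ν 1))]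
  rw [map_sum]
  refine Finset.sum_congr rfl fun μ _ => ?_
  rw [map_smul, smul_eq_mul]
  congr 1
  simp only [jac, Matrix.of_apply]
  rw [fderiv_apply hd μ]
  rfl

theorem smooth₀_jac {V : Set (Space m)} {φ : Space m → Space m} (hV : IsOpen V)
    (hφ : ContDiffOn ℝ ∞ φ V) : Smooth₀ V (jac φ) := fun μ ν =>
  ((contDiffOn_pi.1 hφ μ).fderiv_of_isOpen hV (m := ∞) (by simp)).clm_apply contDiffOn_const

theorem Smooth₀.comp {V : Set (Space m)} {φ : Space m → Space m} {M : ZeroForm m ι κ}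
    (hM : Smooth₀ U M) (hφ : ContDiffOn ℝ ∞ φ V) (hmap : Set.MapsTo φ V U) :
    Smooth₀ V (fun y => M (φ y)) := fun i j => (hM i j).comp hφ hmap

theorem Smooth₁.pullback {V : Set (Space m)} {φ : Space m → Space m} {B : OneForm m ι κ}
    (hB : Smooth₁ U B) (hV : IsOpen V) (hφ : ContDiffOn ℝ ∞ φ V) (hmap : Set.MapsTo φ V U) :
    Smooth₁ V (pullback φ B) := fun ν =>
  Smooth₀.sum fun μ _ => Smooth₀.smul (smooth₀_jac hV hφ μ ν) ((hB μ).comp hφ hmap)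

/-- Gauge transformations commute with pullbacks. -/
theorem act_pullback [Fintype ι] [DecidableEq ι] {V : Set (Space m)} {φ : Space m → Space m}
    {B : OneForm m ι ι} {u : ZeroForm m ι ι} {y : Space m}
    (hU : IsOpen U) (hV : IsOpen V) (hφ : ContDiffOn ℝ ∞ φ V) (hmap : Set.MapsTo φ V U)
    (hu : Smooth₀ U u) (hy : y ∈ V) (ν : Fin m) :
    act (pullback φ B) (fun z => u (φ z)) y ν = pullback φ (act B u) y ν := by
  simp only [act, pullback, pd_comp hU hV hφ hmap hu hy, Matrix.mul_sum, Matrix.sum_mul,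
    smul_add, Finset.sum_add_distrib, Matrix.mul_smul, Matrix.smul_mul]

end Calculus

/-! ### Algebra of block matrices -/

section BlockAlgebra

open Matrix

variable {m : ℕ}

theorem exists_block3 (M : Matrix (Idx m) (Idx m) ℝ) :
    ∃ a b c d e f g h i, M = block3 a b c d e f g h i := by
  refine ⟨blk11 M, blk12 M, of fun i j => M (Sum.inl i) (Sum.inr (Sum.inr j)), blk21 M, blk22 M,
    of fun i j => M (Sum.inr (Sum.inl i)) (Sum.inr (Sum.inr j)),
    of fun i j => M (Sum.inr (Sum.inr i)) (Sum.inl j),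
    of fun i j => M (Sum.inr (Sum.inr i)) (Sum.inr (Sum.inl j)),
    of fun i j => M (Sum.inr (Sum.inr i)) (Sum.inr (Sum.inr j)), ?_⟩
  ext (i | i | i) (j | j | j) <;> rfl

section Block3

variable {a a' : Matrix Unit Unit ℝ} {b b' : Matrix Unit (Fin m) ℝ} {c c' : Matrix Unit Unit ℝ}
  {d d' : Matrix (Fin m) Unit ℝ} {e e' : Matrix (Fin m) (Fin m) ℝ} {f f' : Matrix (Fin m) Unit ℝ}
  {g g' : Matrix Unit Unit ℝ} {h h' : Matrix Unit (Fin m) ℝ} {i i' : Matrix Unit Unit ℝ}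

theorem block3_mul : block3 a b c d e f g h i * block3 a' b' c' d' e' f' g' h' i' =
    block3 (a * a' + b * d' + c * g') (a * b' + b * e' + c * h') (a * c' + b * f' + c * i')
      (d * a' + e * d' + f * g') (d * b' + e * e' + f * h') (d * c' + e * f' + f * i')
      (g * a' + h * d' + i * g') (g * b' + h * e' + i * h') (g * c' + h * f' + i * i') := by
  ext (p | p | p) (r | r | r) <;>
    simp [block3, mul_apply, Fintype.sum_sum_type, add_assoc]

theorem block3_add : block3 a b c d e f g h i + block3 a' b' c' d' e' f' g' h' i' =
    block3 (a + a') (b + b') (c + c') (d + d') (e + e') (f + f') (g + g') (h + h') (i + i') := by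
  ext (p | p | p) (r | r | r) <;> rfl

theorem block3_sub : block3 a b c d e f g h i - block3 a' b' c' d' e' f' g' h' i' =
    block3 (a - a') (b - b') (c - c') (d - d') (e - e') (f - f') (g - g') (h - h') (i - i') := by
  ext (p | p | p) (r | r | r) <;> rfl

theorem block3_neg : -block3 a b c d e f g h i =
    block3 (-a) (-b) (-c) (-d) (-e) (-f) (-g) (-h) (-i) := by
  ext (p | p | p) (r | r | r) <;> rfl

theorem block3_transpose : (block3 a b c d e f g h i).transpose =
    block3 a.transpose d.transpose g.transpose b.transpose e.transpose h.transpose c.transpose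
      f.transpose i.transpose := by
  ext (p | p | p) (r | r | r) <;> rfl

theorem block3_one : block3 1 0 0 0 1 0 0 0 1 = (1 : Matrix (Idx m) (Idx m) ℝ) := by
  ext (p | p | p) (r | r | r) <;> simp [block3, one_apply]

theorem blk11_block3 : blk11 (block3 a b c d e f g h i) = a := rfl
theorem blk12_block3 : blk12 (block3 a b c d e f g h i) = b := rfl
theorem blk21_block3 : blk21 (block3 a b c d e f g h i) = d := rfl
theorem blk22_block3 : blk22 (block3 a b c d e f g h i) = e := rfl

theorem block3_inj : block3 a b c d e f g h i = block3 a' b' c' d' e' f' g' h' i' ↔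
    a = a' ∧ b = b' ∧ c = c' ∧ d = d' ∧ e = e' ∧ f = f' ∧ g = g' ∧ h = h' ∧ i = i' := by
  simp only [block3, fromBlocks_inj, fromCols_inj.eq_iff, fromRows_inj.eq_iff]
  tauto

end Block3

theorem pd_block3 (a : ZeroForm m Unit Unit) (b : ZeroForm m Unit (Fin m))
    (c : ZeroForm m Unit Unit) (d : ZeroForm m (Fin m) Unit) (e : ZeroForm m (Fin m) (Fin m))
    (f : ZeroForm m (Fin m) Unit) (g : ZeroForm m Unit Unit) (h : ZeroForm m Unit (Fin m))
    (i : ZeroForm m Unit Unit) (μ : Fin m) (x : Space m) :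
    pd μ (fun y => block3 (a y) (b y) (c y) (d y) (e y) (f y) (g y) (h y) (i y)) x =
      block3 (pd μ a x) (pd μ b x) (pd μ c x) (pd μ d x) (pd μ e x) (pd μ f x) (pd μ g x)
        (pd μ h x) (pd μ i x) := by
  ext (p | p | p) (r | r | r) <;> rfl

theorem transpose_unit (a : Matrix Unit Unit ℝ) : a.transpose = a := rfl

/-! ### The forms `η` and `Σ`, and the Lie algebra. -/

theorem eta_transpose : (eta m).transpose = eta m := diagonal_transpose _

theorem eta_mul_eta : eta m * eta m = 1 := by
  rw [eta, diagonal_mul_diagonal, ← diagonal_one]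
  congr 1
  ext i
  split_ifs <;> norm_num

theorem eta_mul_eta_cancel {κ : Type} (A : Matrix (Fin m) κ ℝ) : eta m * (eta m * A) = A := by
  rw [← Matrix.mul_assoc, eta_mul_eta, Matrix.one_mul]

theorem eta_inv : (eta m)⁻¹ = eta m := inv_eq_left_inv eta_mul_eta

theorem isUnit_det_eta : IsUnit (eta m).det :=
  (isUnit_iff_isUnit_det _).1 (IsUnit.of_mul_eq_one _ eta_mul_eta)

theorem rowT_eq (r : Matrix Unit (Fin m) ℝ) : rowT r = eta m * r.transpose := by
  rw [rowT, eta_inv, transpose_mul, eta_transpose]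

theorem rowT_zero : rowT (0 : Matrix Unit (Fin m) ℝ) = 0 := by simp [rowT_eq]

theorem rowT_add (r s : Matrix Unit (Fin m) ℝ) : rowT (r + s) = rowT r + rowT s := by
  simp [rowT_eq, Matrix.mul_add]

theorem mul_rowT_comm (r s : Matrix Unit (Fin m) ℝ) : r * rowT s = s * rowT r := by
  rw [← transpose_unit (r * rowT s)]
  simp [rowT_eq, transpose_mul, eta_transpose, Matrix.mul_assoc]

theorem sigma_transpose : (sigma m).transpose = sigma m := by
  simp [sigma, block3_transpose, eta_transpose]

theorem sigma_mul_sigma : sigma m * sigma m = 1 := by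
  simp [sigma, block3_mul, eta_mul_eta, block3_one]

theorem mem_lieG_iff {M : Matrix (Idx m) (Idx m) ℝ} :
    M ∈ lieG m ↔ M.transpose * sigma m = -(sigma m * M) := by
  rw [lieG, mem_skewAdjointMatricesSubmodule, Matrix.IsSkewAdjoint, Matrix.IsAdjointPair,
    Matrix.mul_neg]

/-- The block form of the elements of `𝔤`. -/
theorem exists_of_mem_lieG {M : Matrix (Idx m) (Idx m) ℝ} (hM : M ∈ lieG m) :
    ∃ a α θ A, A.transpose * eta m = -(eta m * A) ∧
      M = block3 a α 0 θ A (rowT α) 0 (θ.transpose * eta m) (-a) := by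
  obtain ⟨a, b, c, d, e, f, g, h, i, rfl⟩ := exists_block3 M
  rw [mem_lieG_iff, sigma, block3_transpose, block3_mul, block3_mul, block3_neg, block3_inj] at hM
  simp only [transpose_unit, Matrix.mul_zero, Matrix.zero_mul, zero_add, add_zero, Matrix.mul_neg,
    Matrix.neg_mul, Matrix.mul_one, Matrix.one_mul, neg_neg] at hM
  obtain ⟨h1, h2, h3, h4, h5, h6, h7, h8, h9⟩ := hM
  -- The corner blocks `(3,1)` and `(1,3)` are `1 × 1`, and the relation makes each equal to its own
  -- negative.
  have hg : g = 0 := by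
    ext; have := congrFun (congrFun h1 ()) (); simp at this ⊢; linarith
  have hc : c = 0 := by
    ext; have := congrFun (congrFun h9 ()) (); simp at this ⊢; linarith
  refine ⟨a, b, d, e, h5, ?_⟩
  rw [block3_inj]
  refine ⟨rfl, rfl, hc, rfl, rfl, ?_, hg, h2.symm, ?_⟩
  · rw [rowT_eq, ← neg_neg b.transpose, h6, neg_neg, eta_mul_eta_cancel]
  · rw [← h7, neg_neg]

/-! ### The groups -/

section Groups

variable {S S' : Matrix (Fin m) (Fin m) ℝ} {r s : Matrix Unit (Fin m) ℝ}

/-- The inverse of `S` is `η Sᵀ η`. -/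
theorem isUnit_det_of_lorentz (hS : S.transpose * eta m * S = eta m) : IsUnit S.det := by
  refine (isUnit_iff_isUnit_det _).1 (IsUnit.of_mul_eq_one_right (eta m * S.transpose * eta m) ?_)
  rw [Matrix.mul_assoc, Matrix.mul_assoc, ← Matrix.mul_assoc S.transpose, hS, eta_mul_eta]

theorem lorentz_mul_transpose (hS : S.transpose * eta m * S = eta m) :
    S * eta m * S.transpose = eta m := by
  have h : eta m * S.transpose * eta m * S = 1 := by
    rw [Matrix.mul_assoc, Matrix.mul_assoc, ← Matrix.mul_assoc S.transpose, hS, eta_mul_eta]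
  rw [mul_eq_one_comm] at h
  calc S * eta m * S.transpose = S * (eta m * S.transpose * eta m) * eta m := by
        simp only [Matrix.mul_assoc, eta_mul_eta, Matrix.mul_one]
    _ = eta m := by rw [h, Matrix.one_mul]

theorem mul_rowT_mul_lorentz (hS : S.transpose * eta m * S = eta m) :
    S * rowT (r * S) = rowT r := by
  rw [rowT_eq, rowT_eq, transpose_mul, ← Matrix.mul_assoc, ← Matrix.mul_assoc,
    lorentz_mul_transpose hS]

theorem inversion_zero : inversion (0 : Matrix Unit (Fin m) ℝ) = 1 := by
  simp [inversion, rowT_zero, block3_one]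

/-- The scalar `r * rowT s` is symmetric in `r` and `s`, so the corner `½ r rᵗ` polarises correctly
and `K₁` is a copy of the additive group of rows. -/
theorem inversion_mul : inversion r * inversion s = inversion (r + s) := by
  simp only [inversion, block3_mul, block3_inj, rowT_add]
  simp only [Matrix.mul_zero, Matrix.zero_mul, zero_add, add_zero, Matrix.mul_one, Matrix.one_mul,
    Matrix.mul_add, Matrix.add_mul, mul_rowT_comm s r, true_and, and_true]
  refine ⟨add_comm _ _, ?_, add_comm _ _⟩
  module

theorem middle_one : middle (1 : Matrix (Fin m) (Fin m) ℝ) = 1 := block3_one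

theorem middle_mul : middle S * middle S' = middle (S * S') := by
  simp [middle, block3_mul]

/-- The Lorentz group normalises `K₁`; this makes `SO · K₁` a group and carries the compatibility of
`u₁` with `SO`. -/
theorem inversion_mul_middle (hS : S.transpose * eta m * S = eta m) :
    inversion r * middle S = middle S * inversion (r * S) := by
  simp [inversion, middle, block3_mul, mul_rowT_mul_lorentz hS, Matrix.mul_assoc]

theorem isUnit_det_inversion : IsUnit (inversion r).det :=
  (isUnit_iff_isUnit_det _).1 (IsUnit.of_mul_eq_one (inversion (-r))
    (by rw [inversion_mul, add_neg_cancel, inversion_zero]))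

theorem inversion_inv : (inversion r)⁻¹ = inversion (-r) :=
  inv_eq_right_inv (by rw [inversion_mul, add_neg_cancel, inversion_zero])

theorem isUnit_det_middle (hS : IsUnit S.det) : IsUnit (middle S).det :=
  (isUnit_iff_isUnit_det _).1 (IsUnit.of_mul_eq_one (middle S⁻¹)
    (by rw [middle_mul, mul_nonsing_inv _ hS, middle_one]))

theorem middle_inv (hS : IsUnit S.det) : (middle S)⁻¹ = middle S⁻¹ :=
  inv_eq_right_inv (by rw [middle_mul, mul_nonsing_inv _ hS, middle_one])

theorem middle_orthogonal (hS : S.transpose * eta m * S = eta m) :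
    (middle S).transpose * sigma m * middle S = sigma m := by
  simp [middle, sigma, block3_transpose, block3_mul, hS]

theorem inversion_orthogonal : (inversion r).transpose * sigma m * inversion r = sigma m := by
  simp only [inversion, sigma, block3_transpose, block3_mul, block3_inj]
  simp [rowT_eq, transpose_mul, eta_transpose, eta_mul_eta_cancel, Matrix.mul_assoc, eta_mul_eta]
  module

theorem lorentz_one : (1 : Matrix (Fin m) (Fin m) ℝ).transpose * eta m * 1 = eta m := by simp

theorem lorentz_mul (hS : S.transpose * eta m * S = eta m)
    (hS' : S'.transpose * eta m * S' = eta m) :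
    (S * S').transpose * eta m * (S * S') = eta m := by
  rw [transpose_mul]
  calc S'.transpose * S.transpose * eta m * (S * S')
      = S'.transpose * (S.transpose * eta m * S) * S' := by simp only [Matrix.mul_assoc]
    _ = eta m := by rw [hS, hS']

theorem lorentz_inv (hS : S.transpose * eta m * S = eta m) :
    S⁻¹.transpose * eta m * S⁻¹ = eta m := by
  have h := isUnit_det_of_lorentz hS
  conv_lhs => rw [← hS]
  rw [Matrix.mul_assoc, Matrix.mul_assoc, mul_nonsing_inv _ h, Matrix.mul_one, ← Matrix.mul_assoc,
    ← transpose_mul, mul_nonsing_inv _ h, transpose_one, Matrix.one_mul]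

theorem mem_groupSOK₁_iff {M : Matrix (Idx m) (Idx m) ℝ} : M ∈ groupSOK₁ m ↔
    ∃ (S : Matrix (Fin m) (Fin m) ℝ) (r : Matrix Unit (Fin m) ℝ),
      S.transpose * eta m * S = eta m ∧ S.det = 1 ∧ M = middle S * inversion r := by
  constructor
  · rintro ⟨_, ⟨S, h, h', rfl⟩, _, ⟨r, rfl⟩, rfl⟩
    exact ⟨S, r, h, h', rfl⟩
  · rintro ⟨S, r, h, h', rfl⟩
    exact ⟨_, ⟨S, h, h', rfl⟩, _, ⟨r, rfl⟩, rfl⟩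

theorem isUnit_det_of_mem_groupSOK₁ {M : Matrix (Idx m) (Idx m) ℝ} (hM : M ∈ groupSOK₁ m) :
    IsUnit M.det := by
  obtain ⟨S, r, h, -, rfl⟩ := mem_groupSOK₁_iff.1 hM
  rw [det_mul]
  exact (isUnit_det_middle (isUnit_det_of_lorentz h)).mul isUnit_det_inversion

theorem orthogonal_of_mem_groupSOK₁ {M : Matrix (Idx m) (Idx m) ℝ} (hM : M ∈ groupSOK₁ m) :
    M.transpose * sigma m * M = sigma m := by
  obtain ⟨S, r, h, -, rfl⟩ := mem_groupSOK₁_iff.1 hM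
  rw [transpose_mul]
  calc (inversion r).transpose * (middle S).transpose * sigma m * (middle S * inversion r)
      = (inversion r).transpose * ((middle S).transpose * sigma m * middle S) * inversion r := by
        simp only [Matrix.mul_assoc]
    _ = sigma m := by rw [middle_orthogonal h, inversion_orthogonal]

theorem isMatrixGroup_groupSOK₁ : IsMatrixGroup (groupSOK₁ m) := by
  refine ⟨mem_groupSOK₁_iff.2 ⟨1, 0, lorentz_one, det_one, ?_⟩, fun M hM N hN => ?_,
    fun M hM => ⟨isUnit_det_of_mem_groupSOK₁ hM, ?_⟩⟩
  · rw [middle_one, inversion_zero, Matrix.one_mul]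
  · obtain ⟨S, r, h, hd, rfl⟩ := mem_groupSOK₁_iff.1 hM
    obtain ⟨S', r', h', hd', rfl⟩ := mem_groupSOK₁_iff.1 hN
    -- Moving `k(r)` to the right past `diag(1,S',1)` turns `r` into `r S'`.
    refine mem_groupSOK₁_iff.2 ⟨S * S', r * S' + r', lorentz_mul h h', ?_, ?_⟩
    · rw [det_mul, hd, hd', one_mul]
    · rw [← middle_mul, ← inversion_mul, Matrix.mul_assoc, ← Matrix.mul_assoc (inversion r),
        inversion_mul_middle h']
      simp only [Matrix.mul_assoc]
  · obtain ⟨S, r, h, hd, rfl⟩ := mem_groupSOK₁_iff.1 hM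
    refine mem_groupSOK₁_iff.2 ⟨S⁻¹, -r * S⁻¹, lorentz_inv h, ?_, ?_⟩
    · rw [det_nonsing_inv, hd, Ring.inverse_one]
    · rw [Matrix.mul_inv_rev, inversion_inv, middle_inv (isUnit_det_of_lorentz h),
        inversion_mul_middle (lorentz_inv h)]

theorem groupSOK₁_subset_groupH : groupSOK₁ m ⊆ groupH m := by
  rintro _ ⟨S, hS, k, hk, rfl⟩
  refine ⟨1, ⟨1, one_pos, ?_⟩, S, hS, k, hk, by rw [Matrix.one_mul]⟩
  rw [← block3_one, weylMatrix, inv_one]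
  rfl

theorem groupSO_subset_groupSOK₁ : groupSO m ⊆ groupSOK₁ m := fun S hS =>
  ⟨S, hS, 1, ⟨0, inversion_zero.symm⟩, by rw [Matrix.mul_one]⟩

theorem groupK₁_subset_groupSOK₁ : groupK₁ m ⊆ groupSOK₁ m := fun k hk =>
  ⟨1, ⟨1, lorentz_one, det_one, middle_one.symm⟩, k, hk, by rw [Matrix.one_mul]⟩

end Groups

end BlockAlgebra

/-! ### Gauge transformations of conformal Cartan connections -/

section Gauge

open Matrix

variable {m : ℕ} {U : Set (Space m)} {x : Space m} {ϖ : OneForm m (Idx m) (Idx m)}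
  {γ : ZeroForm m (Idx m) (Idx m)}

theorem Smooth₀.block3 {a : ZeroForm m Unit Unit} {b : ZeroForm m Unit (Fin m)}
    {c : ZeroForm m Unit Unit} {d : ZeroForm m (Fin m) Unit} {e : ZeroForm m (Fin m) (Fin m)}
    {f : ZeroForm m (Fin m) Unit} {g : ZeroForm m Unit Unit} {h : ZeroForm m Unit (Fin m)}
    {i : ZeroForm m Unit Unit} (ha : Smooth₀ U a) (hb : Smooth₀ U b) (hc : Smooth₀ U c)
    (hd : Smooth₀ U d) (he : Smooth₀ U e) (hf : Smooth₀ U f) (hg : Smooth₀ U g)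
    (hh : Smooth₀ U h) (hi : Smooth₀ U i) :
    Smooth₀ U (fun y => block3 (a y) (b y) (c y) (d y) (e y) (f y) (g y) (h y) (i y)) := by
  rintro (p | p | p) (r | r | r)
  exacts [ha p r, hb p r, hc p r, hd p r, he p r, hf p r, hg p r, hh p r, hi p r]

theorem Smooth₀.rowT {r : ZeroForm m Unit (Fin m)} (hr : Smooth₀ U r) :
    Smooth₀ U (fun y => rowT (r y)) :=
  (hr.mul (smooth₀_const _)).transpose

theorem Smooth₀.inversion {r : ZeroForm m Unit (Fin m)} (hr : Smooth₀ U r) :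
    Smooth₀ U (fun y => inversion (r y)) :=
  Smooth₀.block3 (smooth₀_const _) hr ((hr.mul hr.rowT).const_smul _) (smooth₀_const _)
    (smooth₀_const _) hr.rowT (smooth₀_const _) (smooth₀_const _) (smooth₀_const _)

theorem Smooth₀.middle {S : ZeroForm m (Fin m) (Fin m)} (hS : Smooth₀ U S) :
    Smooth₀ U (fun y => middle (S y)) :=
  Smooth₀.block3 (smooth₀_const _) (smooth₀_const _) (smooth₀_const _) (smooth₀_const _) hS
    (smooth₀_const _) (smooth₀_const _) (smooth₀_const _) (smooth₀_const _)

theorem IsCartanConnection.smooth_vielbein (h : IsCartanConnection U ϖ) :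
    Smooth₀ U (vielbein ϖ) := fun a μ => h.smooth μ (Sum.inr (Sum.inl a)) (Sum.inl ())

theorem IsCartanConnection.smooth_aRow (h : IsCartanConnection U ϖ) :
    Smooth₀ U (aRow ϖ) := fun _ μ => h.smooth μ (Sum.inl ()) (Sum.inl ())

theorem IsCartanConnection.smooth_q (h : IsCartanConnection U ϖ) : Smooth₀ U (q ϖ) :=
  h.smooth_aRow.mul (h.smooth_vielbein.inv h.soldering)

theorem IsCartanConnection.isGauge_u₁ (h : IsCartanConnection U ϖ) :
    IsGauge U (groupK₁ m) (u₁ ϖ) :=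
  ⟨h.smooth_q.inversion, fun _ _ => ⟨_, rfl⟩⟩

theorem IsGauge.mono {K K' : Set (Matrix (Idx m) (Idx m) ℝ)} (h : IsGauge U K γ) (hK : K ⊆ K') :
    IsGauge U K' γ := ⟨h.1, fun x hx => hK (h.2 x hx)⟩

theorem middle_mul_inversion {S : Matrix (Fin m) (Fin m) ℝ} {r : Matrix Unit (Fin m) ℝ} :
    middle S * inversion r =
      block3 1 r ((1 / 2 : ℝ) • (r * rowT r)) 0 S (S * rowT r) 0 0 1 := by
  simp [middle, inversion, block3_mul]

theorem blk22_inversion (r : Matrix Unit (Fin m) ℝ) : blk22 (inversion r) = 1 := rfl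
theorem blk12_inversion (r : Matrix Unit (Fin m) ℝ) : blk12 (inversion r) = r := rfl
theorem blk22_middle (S : Matrix (Fin m) (Fin m) ℝ) : blk22 (middle S) = S := rfl
theorem blk12_middle (S : Matrix (Fin m) (Fin m) ℝ) : blk12 (middle S) = 0 := rfl

/-- The factors `S` and `r` are blocks of the product, so along a gauge transformation they are
entries of `γ` and no choice is involved. -/
theorem blocks_of_mem_groupSOK₁ {M : Matrix (Idx m) (Idx m) ℝ} (hM : M ∈ groupSOK₁ m) :
    (blk22 M).transpose * eta m * blk22 M = eta m ∧ (blk22 M).det = 1 ∧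
      M = middle (blk22 M) * inversion (blk12 M) := by
  obtain ⟨S, r, h, hd, rfl⟩ := mem_groupSOK₁_iff.1 hM
  rw [middle_mul_inversion, blk22_block3, blk12_block3, middle_mul_inversion]
  exact ⟨h, hd, rfl⟩

/-- Conjugation by a `Σ`-orthogonal matrix preserves `𝔤`, and differentiating `γᵀ Σ γ = Σ` puts `γ⁻¹
dγ` in `𝔤`. The inverse is `Σ γᵀ Σ`. -/
theorem act_mem_lieG (hU : IsOpen U) (hϖ : ∀ x ∈ U, ∀ μ, ϖ x μ ∈ lieG m) (hγ : Smooth₀ U γ)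
    (ho : ∀ x ∈ U, (γ x).transpose * sigma m * γ x = sigma m)
    (hx : x ∈ U) (μ : Fin m) : act ϖ γ x μ ∈ lieG m := by
  have hinv : (γ x)⁻¹ = sigma m * (γ x).transpose * sigma m := by
    refine inv_eq_left_inv ?_
    rw [Matrix.mul_assoc, Matrix.mul_assoc, ← Matrix.mul_assoc (γ x).transpose, ho x hx,
      sigma_mul_sigma]
  have hd : (pd μ γ x).transpose * (sigma m * γ x) + (γ x).transpose * (sigma m * pd μ γ x) = 0 := by
    have := pd_congr hU hx (N := fun _ => sigma m) ho μ
    rw [pd_const, pd_mul hU hx (hγ.transpose.mul (smooth₀_const _)) hγ,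
      pd_mul hU hx hγ.transpose (smooth₀_const _), pd_const, pd_transpose] at this
    simpa only [Matrix.mul_zero, add_zero, Matrix.mul_assoc] using this
  have hσ : ∀ A : Matrix (Idx m) (Idx m) ℝ, sigma m * (sigma m * A) = A := fun A => by
    rw [← Matrix.mul_assoc, sigma_mul_sigma, Matrix.one_mul]
  have hm := mem_lieG_iff.1 (hϖ x hx μ)
  have hm' : (ϖ x μ).transpose * (sigma m * γ x) = -(sigma m * (ϖ x μ * γ x)) := by
    rw [← Matrix.mul_assoc, hm, Matrix.neg_mul, Matrix.mul_assoc]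
  rw [mem_lieG_iff, act, hinv]
  simp only [transpose_add, transpose_mul, transpose_transpose, sigma_transpose, Matrix.add_mul,
    Matrix.mul_add, Matrix.mul_assoc, hσ, sigma_mul_sigma, Matrix.mul_one, hm', neg_add,
    Matrix.mul_neg]
  rw [eq_neg_of_add_eq_zero_left hd]

/-- The zeros come from the constant first column and last row of elements of `SO · K₁`. -/
theorem pd_gauge (hU : IsOpen U) (hγ : IsGauge U (groupSOK₁ m) γ) (hx : x ∈ U) (μ : Fin m) :
    ∃ b c e f, pd μ γ x = block3 0 b c 0 e f 0 0 0 := by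
  have h : ∀ y ∈ U, γ y = block3 1 (blk12 (γ y))
      ((1 / 2 : ℝ) • (blk12 (γ y) * rowT (blk12 (γ y)))) 0 (blk22 (γ y))
      (blk22 (γ y) * rowT (blk12 (γ y))) 0 0 1 := fun y hy => by
    rw [← middle_mul_inversion, ← (blocks_of_mem_groupSOK₁ (hγ.2 y hy)).2.2]
  rw [pd_congr hU hx h, pd_block3]
  simp only [pd_const]
  exact ⟨_, _, _, _, rfl⟩

/-- The first column of `γ⁻¹ dγ` vanishes, so only `γ⁻¹ ϖ γ` contributes to these two blocks. The
other blocks do involve `dγ`, which is why the dressing fields are built from `a` and `θ`. -/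
theorem blk_act (hU : IsOpen U) (hϖ : IsCartanConnection U ϖ) (hγ : IsGauge U (groupSOK₁ m) γ)
    (hx : x ∈ U) (μ : Fin m) :
    blk21 (act ϖ γ x μ) = (blk22 (γ x))⁻¹ * blk21 (ϖ x μ) ∧
      blk11 (act ϖ γ x μ) =
        blk11 (ϖ x μ) - blk12 (γ x) * (blk22 (γ x))⁻¹ * blk21 (ϖ x μ) := by
  obtain ⟨b, c, e, f, hpd⟩ := pd_gauge hU hγ hx μ
  obtain ⟨a, α, θ, A, -, hA⟩ := exists_of_mem_lieG (hϖ.mem_lieG x hx μ)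
  obtain ⟨hS, -, hγx⟩ := blocks_of_mem_groupSOK₁ (hγ.2 x hx)
  have hinv : (γ x)⁻¹ = inversion (-blk12 (γ x)) * middle (blk22 (γ x))⁻¹ := by
    conv_lhs => rw [hγx]
    rw [Matrix.mul_inv_rev, inversion_inv, middle_inv (isUnit_det_of_lorentz hS)]
  generalize blk22 (γ x) = S at *
  generalize blk12 (γ x) = r at *
  rw [act, hinv, hpd, hγx, hA, middle_mul_inversion]
  simp only [inversion, middle, block3_mul, block3_add, blk21_block3, blk11_block3]
  simp [Matrix.mul_assoc, sub_eq_add_neg]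

theorem vielbein_act (hU : IsOpen U) (hϖ : IsCartanConnection U ϖ)
    (hγ : IsGauge U (groupSOK₁ m) γ) (hx : x ∈ U) :
    vielbein (act ϖ γ) x = (blk22 (γ x))⁻¹ * vielbein ϖ x := by
  ext a μ
  exact congrFun (congrFun (blk_act hU hϖ hγ hx μ).1 a) ()

theorem aRow_act (hU : IsOpen U) (hϖ : IsCartanConnection U ϖ)
    (hγ : IsGauge U (groupSOK₁ m) γ) (hx : x ∈ U) :
    aRow (act ϖ γ) x = aRow ϖ x - blk12 (γ x) * (blk22 (γ x))⁻¹ * vielbein ϖ x := by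
  ext a μ
  exact congrFun (congrFun (blk_act hU hϖ hγ hx μ).2 ()) ()

/-- `(a - r S⁻¹ e)(S⁻¹ e)⁻¹ = q S - r`: the shift by `r` is what lets `k(q)` absorb `K₁`. -/
theorem q_act (hU : IsOpen U) (hϖ : IsCartanConnection U ϖ)
    (hγ : IsGauge U (groupSOK₁ m) γ) (hx : x ∈ U) :
    q (act ϖ γ) x = q ϖ x * blk22 (γ x) - blk12 (γ x) := by
  have hS := isUnit_det_of_lorentz (blocks_of_mem_groupSOK₁ (hγ.2 x hx)).1
  rw [q, q, aRow_act hU hϖ hγ hx, vielbein_act hU hϖ hγ hx, Matrix.mul_inv_rev,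
    nonsing_inv_nonsing_inv _ hS, Matrix.sub_mul, ← Matrix.mul_assoc, ← Matrix.mul_assoc,
    mul_nonsing_inv_cancel_right _ _ (hϖ.soldering x hx), nonsing_inv_mul_cancel_right _ _ hS]

theorem IsCartanConnection.act (hU : IsOpen U) (hϖ : IsCartanConnection U ϖ)
    (hγ : IsGauge U (groupSOK₁ m) γ) : IsCartanConnection U (act ϖ γ) where
  smooth := hϖ.smooth.act hU hγ.1 fun x hx => isUnit_det_of_mem_groupSOK₁ (hγ.2 x hx)
  mem_lieG _ hx μ := act_mem_lieG hU hϖ.mem_lieG hγ.1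
    (fun x hx => orthogonal_of_mem_groupSOK₁ (hγ.2 x hx)) hx μ
  soldering x hx := by
    have hS := isUnit_det_of_lorentz (blocks_of_mem_groupSOK₁ (hγ.2 x hx)).1
    rw [vielbein_act hU hϖ hγ hx, det_mul]
    exact (isUnit_nonsing_inv_det _ hS).mul (hϖ.soldering x hx)

/-! ### The dressing fields -/

theorem u₁_act_K₁ (hU : IsOpen U) (hϖ : IsCartanConnection U ϖ) (hγ : IsGauge U (groupK₁ m) γ)
    (hx : x ∈ U) : u₁ (act ϖ γ) x = (γ x)⁻¹ * u₁ ϖ x := by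
  rw [u₁, q_act hU hϖ (hγ.mono groupK₁_subset_groupSOK₁) hx]
  obtain ⟨r, hr⟩ := hγ.2 x hx
  rw [hr, inversion_inv, u₁, inversion_mul, blk22_inversion, blk12_inversion, Matrix.mul_one]
  congr 1
  abel

theorem u₀_act_K₁ (hU : IsOpen U) (hϖ : IsCartanConnection U ϖ) (hγ : IsGauge U (groupK₁ m) γ)
    (hx : x ∈ U) : u₀ (act ϖ γ) x = u₀ ϖ x := by
  rw [u₀, vielbein_act hU hϖ (hγ.mono groupK₁_subset_groupSOK₁) hx]
  obtain ⟨r, hr⟩ := hγ.2 x hx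
  rw [hr, blk22_inversion, inv_one, Matrix.one_mul, u₀]

theorem u₁_act_SO (hU : IsOpen U) (hϖ : IsCartanConnection U ϖ) (hγ : IsGauge U (groupSO m) γ)
    (hx : x ∈ U) : u₁ (act ϖ γ) x = (γ x)⁻¹ * u₁ ϖ x * γ x := by
  rw [u₁, q_act hU hϖ (hγ.mono groupSO_subset_groupSOK₁) hx]
  obtain ⟨S, hS, -, h⟩ := hγ.2 x hx
  have hS' := isUnit_det_of_lorentz hS
  rw [h, u₁, Matrix.mul_assoc, inversion_mul_middle hS,
    nonsing_inv_mul_cancel_left _ _ (isUnit_det_middle hS'), blk22_middle, blk12_middle,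
    sub_zero]

theorem u₀_act_SO (hU : IsOpen U) (hϖ : IsCartanConnection U ϖ) (hγ : IsGauge U (groupSO m) γ)
    (hx : x ∈ U) : u₀ (act ϖ γ) x = (γ x)⁻¹ * u₀ ϖ x := by
  rw [u₀, vielbein_act hU hϖ (hγ.mono groupSO_subset_groupSOK₁) hx]
  obtain ⟨S, hS, -, h⟩ := hγ.2 x hx
  rw [h, middle_inv (isUnit_det_of_lorentz hS), u₀, middle_mul, blk22_middle]

/-- `k(qS - r) S⁻¹ e = k(-r) k(qS) S⁻¹ e = k(-r) S⁻¹ k(q) e`: the `S` left on the right of `u₁` is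
absorbed by the `S⁻¹` on the left of `u₀`. -/
theorem u_act (hU : IsOpen U) (hϖ : IsCartanConnection U ϖ) (hγ : IsGauge U (groupSOK₁ m) γ)
    (hx : x ∈ U) : u (act ϖ γ) x = (γ x)⁻¹ * u ϖ x := by
  obtain ⟨hS, -, h⟩ := blocks_of_mem_groupSOK₁ (hγ.2 x hx)
  have hS' := isUnit_det_of_lorentz hS
  rw [u, u, u₁, u₁, u₀, u₀, q_act hU hϖ hγ hx, vielbein_act hU hϖ hγ hx]
  generalize blk22 (γ x) = S at *
  generalize blk12 (γ x) = r at *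
  rw [h, Matrix.mul_inv_rev, inversion_inv, middle_inv hS', ← middle_mul, sub_eq_neg_add,
    ← inversion_mul, Matrix.mul_assoc, ← Matrix.mul_assoc _ (middle S⁻¹),
    inversion_mul_middle (lorentz_inv hS), mul_nonsing_inv_cancel_right _ _ hS']
  simp only [Matrix.mul_assoc]

theorem IsCartanConnection.isDressingField_u₁ (hU : IsOpen U) (hϖ : IsCartanConnection U ϖ) :
    IsDressingField U (groupK₁ m) u₁ ϖ :=
  ⟨hϖ.isGauge_u₁.1, fun _ _ => isUnit_det_inversion, fun _ hγ _ hx => u₁_act_K₁ hU hϖ hγ hx⟩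

theorem IsCartanConnection.isDressingField_u₀ (hU : IsOpen U) (hϖ : IsCartanConnection U ϖ) :
    IsDressingField U (groupSO m) u₀ ϖ :=
  ⟨hϖ.smooth_vielbein.middle, fun x hx => isUnit_det_middle (hϖ.soldering x hx),
    fun _ hγ _ hx => u₀_act_SO hU hϖ hγ hx⟩

theorem IsCartanConnection.isDressingField_u (hU : IsOpen U) (hϖ : IsCartanConnection U ϖ) :
    IsDressingField U (groupSOK₁ m) u ϖ := by
  refine ⟨(hϖ.isDressingField_u₁ hU).1.mul (hϖ.isDressingField_u₀ hU).1, fun x hx => ?_,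
    fun _ hγ _ hx => u_act hU hϖ hγ hx⟩
  rw [u, det_mul]
  exact ((hϖ.isDressingField_u₁ hU).2.1 x hx).mul ((hϖ.isDressingField_u₀ hU).2.1 x hx)

/-! ### Invariance of the dressed fields. -/

theorem varpi₀_act (hU : IsOpen U) (hϖ : IsCartanConnection U ϖ)
    (hγ : IsGauge U (groupSOK₁ m) γ) (hx : x ∈ U) (μ : Fin m) :
    varpi₀ (act ϖ γ) x μ = varpi₀ ϖ x μ := by
  have hγu : ∀ x ∈ U, IsUnit (γ x).det := fun x hx => isUnit_det_of_mem_groupSOK₁ (hγ.2 x hx)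
  have h : ∀ y ∈ U, γ y * u (act ϖ γ) y = u ϖ y := fun y hy => by
    rw [u_act hU hϖ hγ hy, mul_nonsing_inv_cancel_left _ _ (hγu y hy)]
  rw [varpi₀, ← act_mul hU hx hγ.1 ((hϖ.act hU hγ).isDressingField_u hU).1 (hγu x hx), varpi₀]
  exact act_congr hU hx (fun _ => rfl) h μ

theorem Omega₀_eq_curvature (hU : IsOpen U) (hϖ : IsCartanConnection U ϖ) (hx : x ∈ U)
    (μ σ : Fin m) : Omega₀ ϖ x μ σ = curvature (varpi₀ ϖ) x μ σ :=
  have hu := hϖ.isDressingField_u hU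
  (curvature_act hU hx hϖ.smooth hu.1 hu.2.1 μ σ).symm

theorem Omega₀_act (hU : IsOpen U) (hϖ : IsCartanConnection U ϖ)
    (hγ : IsGauge U (groupSOK₁ m) γ) (hx : x ∈ U) (μ σ : Fin m) :
    Omega₀ (act ϖ γ) x μ σ = Omega₀ ϖ x μ σ := by
  rw [Omega₀_eq_curvature hU (hϖ.act hU hγ) hx, Omega₀_eq_curvature hU hϖ hx]
  exact curvature_congr hU hx (fun y hy μ => varpi₀_act hU hϖ hγ hy μ) μ σ

theorem varpi₀_eq_act_varpi₁ (hU : IsOpen U) (hϖ : IsCartanConnection U ϖ) (hx : x ∈ U)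
    (μ : Fin m) : varpi₀ ϖ x μ = act (varpi₁ ϖ) (u₀ ϖ) x μ :=
  act_mul hU hx (hϖ.isDressingField_u₁ hU).1 (hϖ.isDressingField_u₀ hU).1 isUnit_det_inversion μ

end Gauge

/-! ### The dressed connection and its curvature -/

section Dressed

open Matrix

variable {m : ℕ} {U : Set (Space m)} {x : Space m} {ϖ : OneForm m (Idx m) (Idx m)}

/-- As a `K₁`-valued field, `u₁` may be used as a gauge transformation, so all the laws above apply
with `S = 1`, `r = q`. -/
theorem IsCartanConnection.varpi₁ (hU : IsOpen U) (hϖ : IsCartanConnection U ϖ) :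
    IsCartanConnection U (varpi₁ ϖ) :=
  hϖ.act hU (hϖ.isGauge_u₁.mono groupK₁_subset_groupSOK₁)

theorem vielbein_varpi₁ (hU : IsOpen U) (hϖ : IsCartanConnection U ϖ) (hx : x ∈ U) :
    vielbein (varpi₁ ϖ) x = vielbein ϖ x := by
  rw [ConformalCartan.varpi₁,
    vielbein_act hU hϖ (hϖ.isGauge_u₁.mono groupK₁_subset_groupSOK₁) hx, u₁, blk22_inversion,
    inv_one, Matrix.one_mul]

theorem aRow_varpi₁ (hU : IsOpen U) (hϖ : IsCartanConnection U ϖ) (hx : x ∈ U) :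
    aRow (varpi₁ ϖ) x = 0 := by
  rw [ConformalCartan.varpi₁, aRow_act hU hϖ (hϖ.isGauge_u₁.mono groupK₁_subset_groupSOK₁) hx, u₁,
    blk22_inversion, blk12_inversion, inv_one, Matrix.mul_one, q,
    nonsing_inv_mul_cancel_right _ _ (hϖ.soldering x hx), sub_self]

theorem vielbein_mul_dx (μ : Fin m) : vielbein ϖ x * dx x μ = blk21 (ϖ x μ) := by
  ext a b
  simp [mul_apply, dx, vielbein]

theorem varpi₁_eq_block3 (hU : IsOpen U) (hϖ : IsCartanConnection U ϖ) (hx : x ∈ U) (μ : Fin m) :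
    (A₁ ϖ x μ).transpose * eta m = -(eta m * A₁ ϖ x μ) ∧
      varpi₁ ϖ x μ = block3 0 (alpha₁ ϖ x μ) 0
        (vielbein ϖ x * dx x μ) (A₁ ϖ x μ) (rowT (alpha₁ ϖ x μ))
        0 ((vielbein ϖ x * dx x μ).transpose * eta m) 0 := by
  obtain ⟨a, α, θ, A, hA, h⟩ := exists_of_mem_lieG ((hϖ.varpi₁ hU).mem_lieG x hx μ)
  have h1 : blk11 (varpi₁ ϖ x μ) = 0 := by
    ext i j
    exact congrFun (congrFun (aRow_varpi₁ hU hϖ hx) ()) μ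
  rw [← vielbein_varpi₁ hU hϖ hx, vielbein_mul_dx, A₁, alpha₁]
  rw [h, blk11_block3] at h1
  rw [h, h1, blk21_block3, blk12_block3, blk22_block3, neg_zero]
  exact ⟨hA, rfl⟩

theorem IsCartanConnection.smooth_A₁ (hU : IsOpen U) (hϖ : IsCartanConnection U ϖ) :
    Smooth₁ U (A₁ ϖ) := fun μ _ _ => (hϖ.varpi₁ hU).smooth μ _ _

theorem IsCartanConnection.smooth_Gam (hU : IsOpen U) (hϖ : IsCartanConnection U ϖ) :
    Smooth₁ U (Gam ϖ) := (hϖ.smooth_A₁ hU).act hU hϖ.smooth_vielbein hϖ.soldering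

theorem IsCartanConnection.smooth_Pf (hU : IsOpen U) (hϖ : IsCartanConnection U ϖ) :
    Smooth₁ U (Pf ϖ) := fun μ =>
  Smooth₀.mul (fun _ _ => (hϖ.varpi₁ hU).smooth μ _ _) hϖ.smooth_vielbein

theorem IsCartanConnection.smooth_metric (hϖ : IsCartanConnection U ϖ) :
    Smooth₀ U (metric ϖ) :=
  (hϖ.smooth_vielbein.transpose.mul (smooth₀_const _)).mul hϖ.smooth_vielbein

theorem metric_transpose : (metric ϖ x).transpose = metric ϖ x := by
  simp [metric, eta_transpose, Matrix.mul_assoc]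

theorem IsCartanConnection.isUnit_det_metric (hϖ : IsCartanConnection U ϖ) (hx : x ∈ U) :
    IsUnit (metric ϖ x).det := by
  rw [metric, det_mul, det_mul, det_transpose]
  exact ((hϖ.soldering x hx).mul isUnit_det_eta).mul (hϖ.soldering x hx)

theorem inv_metric_transpose : ((metric ϖ x)⁻¹).transpose = (metric ϖ x)⁻¹ := by
  rw [transpose_nonsing_inv, metric_transpose]

theorem varpi₀_eq_block3 (hU : IsOpen U) (hϖ : IsCartanConnection U ϖ) (hx : x ∈ U)
    (μ : Fin m) : varpi₀ ϖ x μ =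
      block3 0 (Pf ϖ x μ) 0
        (dx x μ) (Gam ϖ x μ) ((metric ϖ x)⁻¹ * (Pf ϖ x μ).transpose)
        0 ((dx x μ).transpose * metric ϖ x) 0 := by
  have he := hϖ.soldering x hx
  have hpd : pd μ (u₀ ϖ) x = block3 0 0 0 0 (pd μ (vielbein ϖ) x) 0 0 0 0 := by
    have := pd_block3 (fun _ => 1) (fun _ => 0) (fun _ => 0) (fun _ => 0) (vielbein ϖ)
      (fun _ => 0) (fun _ => 0) (fun _ => 0) (fun _ => 1) μ x
    simp only [pd_const] at this
    exact this
  rw [varpi₀_eq_act_varpi₁ hU hϖ hx, ConformalCartan.act, hpd, u₀, middle_inv he,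
    (varpi₁_eq_block3 hU hϖ hx μ).2]
  simp only [middle, block3_mul, block3_add, Matrix.mul_zero, Matrix.zero_mul, add_zero, zero_add,
    Matrix.mul_one, Matrix.one_mul]
  rw [block3_inj]
  refine ⟨rfl, rfl, rfl, nonsing_inv_mul_cancel_left _ _ he, rfl, ?_, rfl, ?_, rfl⟩
  -- `e⁻¹ η α₁ᵀ = (eᵀ η e)⁻¹ eᵀ α₁ᵀ = g⁻¹ Pᵀ`.
  · have he' : IsUnit (vielbein ϖ x).transpose.det := by rwa [det_transpose]
    rw [Pf, metric, rowT_eq, Matrix.mul_inv_rev, Matrix.mul_inv_rev, eta_inv, transpose_mul]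
    simp only [Matrix.mul_assoc]
    rw [nonsing_inv_mul_cancel_left _ _ he']
  · rw [metric, transpose_mul]
    simp only [Matrix.mul_assoc]

/-- `g Γ = eᵀ η A₁ e + eᵀ η de`; adding the transpose, the `A₁` terms cancel because `A₁` is
`η`-skew, and `dg` remains. -/
theorem nablaMetric_Gam (hU : IsOpen U) (hϖ : IsCartanConnection U ϖ) (hx : x ∈ U) (μ : Fin m) :
    nablaMetric (Gam ϖ) (metric ϖ) x μ = 0 := by
  have he := hϖ.soldering x hx
  have hs := hϖ.smooth_vielbein
  have hg : metric ϖ x * Gam ϖ x μ = (vielbein ϖ x).transpose * eta m * A₁ ϖ x μ * vielbein ϖ x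
      + (vielbein ϖ x).transpose * eta m * pd μ (vielbein ϖ) x := by
    rw [metric, Gam, ConformalCartan.act]
    simp only [Matrix.mul_add, Matrix.mul_assoc, mul_nonsing_inv_cancel_left _ _ he]
  have hg' : (Gam ϖ x μ).transpose * metric ϖ x = (metric ϖ x * Gam ϖ x μ).transpose := by
    rw [transpose_mul, metric_transpose]
  have hd : pd μ (metric ϖ) x = (pd μ (vielbein ϖ) x).transpose * eta m * vielbein ϖ x
      + (vielbein ϖ x).transpose * eta m * pd μ (vielbein ϖ) x := by
    have := pd_mul hU hx (hs.transpose.mul (smooth₀_const (eta m))) hs μ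
    rw [pd_mul hU hx hs.transpose (smooth₀_const _), pd_const, pd_transpose, Matrix.mul_zero,
      add_zero] at this
    exact this
  rw [nablaMetric, hg', hg, hd]
  have hA := (varpi₁_eq_block3 hU hϖ hx μ).1
  simp only [transpose_add, transpose_mul, transpose_transpose, eta_transpose]
  rw [← Matrix.mul_assoc (A₁ ϖ x μ).transpose, hA]
  simp only [Matrix.mul_assoc, Matrix.neg_mul, Matrix.mul_neg]
  abel

theorem transpose_mul_dx_symm (g : Matrix (Fin m) (Fin m) ℝ) (hg : g.transpose = g)
    (μ σ : Fin m) : (dx x μ).transpose * g * dx x σ = (dx x σ).transpose * g * dx x μ := by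
  rw [← transpose_unit ((dx x μ).transpose * g * dx x σ)]
  simp only [transpose_mul, transpose_transpose, hg, Matrix.mul_assoc]

theorem Omega₀_eq_block3 (hU : IsOpen U) (hϖ : IsCartanConnection U ϖ) (hx : x ∈ U)
    (μ σ : Fin m) : Omega₀ ϖ x μ σ =
      block3 (wedge (Pf ϖ) dx x μ σ) (extd (Pf ϖ) x μ σ + wedge (Pf ϖ) (Gam ϖ) x μ σ) 0
        (wedge (Gam ϖ) dx x μ σ)
        (curvature (Gam ϖ) x μ σ + wedge dx (Pf ϖ) x μ σ
          + wedge (fun y κ => (metric ϖ y)⁻¹ * formT (Pf ϖ) y κ)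
              (fun y κ => formT dx y κ * metric ϖ y) x μ σ)
        (wedge (nablaInvMetric (Gam ϖ) (metric ϖ)) (formT (Pf ϖ)) x μ σ
          + (metric ϖ x)⁻¹ * (extd (Pf ϖ) x μ σ + wedge (Pf ϖ) (Gam ϖ) x μ σ).transpose)
        0
        (-wedge (formT dx)
          (fun y κ => nablaMetric (Gam ϖ) (metric ϖ) y κ + formT (Gam ϖ) y κ * metric ϖ y) x μ σ)
        (wedge (formT dx) (formT (Pf ϖ)) x μ σ) := by
  have hgs := hϖ.smooth_metric
  have hgu : ∀ y ∈ U, IsUnit (metric ϖ y).det := fun y hy => hϖ.isUnit_det_metric hy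
  have hP := hϖ.smooth_Pf hU
  have h23 : ∀ μ σ, pd μ (fun y => (metric ϖ y)⁻¹ * (Pf ϖ y σ).transpose) x =
      pd μ (fun y => (metric ϖ y)⁻¹) x * (Pf ϖ x σ).transpose
        + (metric ϖ x)⁻¹ * (pd μ (fun y => Pf ϖ y σ) x).transpose := fun μ σ => by
    rw [pd_mul hU hx (hgs.inv hgu) (hP σ).transpose, pd_transpose]
  have h32 : ∀ μ σ, pd μ (fun y => (dx y σ).transpose * metric ϖ y) x =
      (dx x σ).transpose * pd μ (metric ϖ) x := fun μ σ => by
    have := pd_mul hU hx (smooth₀_const (dx x σ).transpose) hgs μ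
    rw [pd_const, Matrix.zero_mul, zero_add] at this
    exact this
  have h21 : ∀ μ σ, pd μ (fun y : Space m => dx y σ) x = 0 := fun μ σ => pd_const (dx x σ) μ
  have hgg : ∀ A : Matrix (Fin m) Unit ℝ, metric ϖ x * ((metric ϖ x)⁻¹ * A) = A := fun A =>
    mul_nonsing_inv_cancel_left _ _ (hgu x hx)
  rw [Omega₀_eq_curvature hU hϖ hx,
    curvature_congr hU hx fun y hy μ => varpi₀_eq_block3 hU hϖ hy μ]
  simp only [curvature, extd, wedge, pd_block3, block3_mul, block3_sub, block3_add]
  rw [block3_inj]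
  simp only [h21, h32, h23, pd_const, formT, nablaMetric, nablaInvMetric,
    Matrix.mul_zero, Matrix.zero_mul, add_zero, zero_add, sub_self]
  refine ⟨?_, ?_, ?_, ?_, ?_, ?_, ?_, ?_, ?_⟩
  · trivial
  · trivial
  -- The scalar `P_μ g⁻¹ P_σᵀ` is symmetric in `μ`, `σ`, so its antisymmetrisation vanishes.
  · simp only [← Matrix.mul_assoc]
    rw [← transpose_unit (Pf ϖ x μ * (metric ϖ x)⁻¹ * _)]
    simp only [transpose_mul, transpose_transpose, inv_metric_transpose, Matrix.mul_assoc, sub_self]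
  · trivial
  · abel
  -- `(P ∧ Γ)ᵀ = -Γᵀ ∧ Pᵀ`, so the `Γᵀ` terms of `∇g⁻¹` and of `Cᵀ` cancel.
  · simp only [transpose_add, transpose_sub, transpose_mul, Matrix.mul_add, Matrix.add_mul,
      Matrix.mul_sub, Matrix.mul_assoc]
    abel
  · rw [transpose_mul_dx_symm _ metric_transpose, sub_self]
  · simp only [Matrix.mul_add, Matrix.mul_sub, Matrix.mul_assoc]
    abel
  · simp only [Matrix.mul_assoc, hgg]

end Dressed

/-! ### Changes of coordinates -/

section CoordChange

open Matrix

variable {m : ℕ} {U V : Set (Space m)} {φ : Space m → Space m} {y : Space m}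
  {ϖ : OneForm m (Idx m) (Idx m)}

theorem vielbein_pullback : vielbein (pullback φ ϖ) y = vielbein ϖ (φ y) * jac φ y := by
  ext a ν
  simp [vielbein, pullback, blk21, mul_apply, Matrix.sum_apply, mul_comm]

theorem aRow_pullback : aRow (pullback φ ϖ) y = aRow ϖ (φ y) * jac φ y := by
  ext a ν
  simp [aRow, pullback, blk11, mul_apply, Matrix.sum_apply, mul_comm]

theorem blk12_pullback (B : OneForm m (Idx m) (Idx m)) (ν : Fin m) :
    blk12 (pullback φ B y ν) = pullback φ (fun x μ => blk12 (B x μ)) y ν := by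
  ext a b
  simp [pullback, blk12, Matrix.sum_apply]

theorem blk22_pullback (B : OneForm m (Idx m) (Idx m)) (ν : Fin m) :
    blk22 (pullback φ B y ν) = pullback φ (fun x μ => blk22 (B x μ)) y ν := by
  ext a b
  simp [pullback, blk22, Matrix.sum_apply]

/-- Both `a` and `e` acquire a factor `J` on the right, which cancels in `a e⁻¹`; hence `u₁` is
pulled back as a function. -/
theorem q_pullback (hJ : IsUnit (jac φ y).det) : q (pullback φ ϖ) y = q ϖ (φ y) := by
  rw [q, q, vielbein_pullback, aRow_pullback, Matrix.mul_inv_rev, ← Matrix.mul_assoc,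
    mul_nonsing_inv_cancel_right _ _ hJ]

theorem IsCartanConnection.pullback (hϖ : IsCartanConnection U ϖ) (hφ : IsCoordChange V U φ) :
    IsCartanConnection V (pullback φ ϖ) where
  smooth := hϖ.smooth.pullback hφ.1 hφ.2.2.1 hφ.2.1.mapsTo
  mem_lieG y hy _ := Submodule.sum_mem _ fun μ _ =>
    Submodule.smul_mem _ _ (hϖ.mem_lieG _ (hφ.2.1.mapsTo hy) μ)
  soldering y hy := by
    rw [vielbein_pullback, det_mul]
    exact (hϖ.soldering _ (hφ.2.1.mapsTo hy)).mul (hφ.2.2.2 y hy)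

theorem metric_pullback : metric (pullback φ ϖ) y =
    (jac φ y).transpose * metric ϖ (φ y) * jac φ y := by
  rw [metric, metric, vielbein_pullback, transpose_mul]
  simp only [Matrix.mul_assoc]

theorem varpi₁_pullback (hU : IsOpen U) (hϖ : IsCartanConnection U ϖ)
    (hφ : IsCoordChange V U φ) (hy : y ∈ V) (ν : Fin m) :
    varpi₁ (pullback φ ϖ) y ν = pullback φ (varpi₁ ϖ) y ν := by
  rw [varpi₁, varpi₁, ← act_pullback hU hφ.1 hφ.2.2.1 hφ.2.1.mapsTo hϖ.isGauge_u₁.1 hy]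
  refine act_congr hφ.1 hy (fun _ => rfl) (fun z hz => ?_) ν
  rw [u₁, u₁, q_pullback (hφ.2.2.2 z hz)]

theorem Pf_pullback (hU : IsOpen U) (hϖ : IsCartanConnection U ϖ)
    (hφ : IsCoordChange V U φ) (hy : y ∈ V) (ν : Fin m) :
    Pf (pullback φ ϖ) y ν = pullback φ (Pf ϖ) y ν * jac φ y := by
  rw [Pf, alpha₁, varpi₁_pullback hU hϖ hφ hy, blk12_pullback, vielbein_pullback,
    ← Matrix.mul_assoc]
  congr 1
  simp only [ConformalCartan.pullback, Matrix.sum_mul, Matrix.smul_mul]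
  rfl

/-- Dressing by `e J` is dressing by `e` followed by `J`, and the first step commutes with the
pullback. -/
theorem Gam_pullback (hU : IsOpen U) (hϖ : IsCartanConnection U ϖ)
    (hφ : IsCoordChange V U φ) (hy : y ∈ V) (ν : Fin m) :
    Gam (pullback φ ϖ) y ν =
      (jac φ y)⁻¹ * pullback φ (Gam ϖ) y ν * jac φ y + (jac φ y)⁻¹ * pd ν (jac φ) y := by
  have hmap := hφ.2.1.mapsTo
  have hA : ∀ κ, A₁ (pullback φ ϖ) y κ = pullback φ (A₁ ϖ) y κ := fun κ => by
    rw [A₁, varpi₁_pullback hU hϖ hφ hy, blk22_pullback]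
    rfl
  rw [Gam, act_congr hφ.1 hy hA (fun z _ => vielbein_pullback),
    act_mul hφ.1 hy (hϖ.smooth_vielbein.comp hφ.2.2.1 hmap) (smooth₀_jac hφ.1 hφ.2.2.1)
      (hϖ.soldering _ (hmap hy)), act,
    act_pullback hU hφ.1 hφ.2.2.1 hmap hϖ.smooth_vielbein hy]
  rfl

end CoordChange

/-! ### Normal connections -/

section Normal

open Matrix

variable {m : ℕ} {ι : Type} {U : Set (Space m)} {x : Space m} {ϖ : OneForm m (Idx m) (Idx m)}

/-- If a 1-form is skew for a constant bilinear form, then so is its curvature. -/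
theorem curvature_skew [Fintype ι] {B : OneForm m ι ι} {J : Matrix ι ι ℝ} (hU : IsOpen U)
    (hB : Smooth₁ U B) (h : ∀ x ∈ U, ∀ μ, (B x μ).transpose * J = -(J * B x μ)) (hx : x ∈ U)
    (μ σ : Fin m) :
    (curvature B x μ σ).transpose * J = -(J * curvature B x μ σ) := by
  have hpd : ∀ μ σ, (pd μ (fun y => B y σ) x).transpose * J = -(J * pd μ (fun y => B y σ) x) := by
    intro μ σ
    have := pd_congr hU hx (fun y hy => h y hy σ) μ
    rw [pd_mul hU hx (hB σ).transpose (smooth₀_const J), pd_neg,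
      pd_mul hU hx (smooth₀_const J) (hB σ), pd_const, pd_transpose] at this
    simpa using this
  -- The two signs cancel and transposition reverses the factors, so it is the commutator that is
  -- skew.
  have hmul : ∀ μ σ, (B x μ * B x σ).transpose * J = J * (B x σ * B x μ) := by
    intro μ σ
    rw [transpose_mul, Matrix.mul_assoc, h x hx, Matrix.mul_neg, ← Matrix.mul_assoc, h x hx,
      Matrix.neg_mul, neg_neg, Matrix.mul_assoc]
  simp only [curvature, extd, wedge, transpose_add, transpose_sub, Matrix.add_mul, Matrix.sub_mul,
    hpd, hmul, Matrix.mul_add, Matrix.mul_sub]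
  abel

theorem trace_eq_zero_of_skew_eta {A : Matrix (Fin m) (Fin m) ℝ}
    (h : A.transpose * eta m = -(eta m * A)) : A.trace = 0 := by
  have h1 : A.trace = -A.trace := by
    conv_lhs => rw [← eta_mul_eta_cancel A, ← neg_neg (eta m * A), ← h, Matrix.mul_neg, trace_neg,
      trace_mul_comm, Matrix.mul_assoc, eta_mul_eta, Matrix.mul_one, trace_transpose]
  linarith

/-- The curvature is `𝔤`-valued, so `Θ = 0` kills block `(3,2)` as well. `Ω` is then block upper
triangular, and conjugation by the unipotent `u₁` leaves its diagonal blocks unchanged. -/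
theorem Omega₀_of_torsion_eq_zero (hU : IsOpen U) (hϖ : IsCartanConnection U ϖ) (hx : x ∈ U)
    {μ σ : Fin m} (hT : blk21 (curvature ϖ x μ σ) = 0) :
    blk21 (Omega₀ ϖ x μ σ) = 0 ∧ blk22 (Omega₀ ϖ x μ σ) =
      (vielbein ϖ x)⁻¹ * blk22 (curvature ϖ x μ σ) * vielbein ϖ x := by
  have he := hϖ.soldering x hx
  obtain ⟨a, α, θ, A, -, h⟩ := exists_of_mem_lieG (mem_lieG_iff.2
    (curvature_skew hU hϖ.smooth (fun x hx μ => mem_lieG_iff.1 (hϖ.mem_lieG x hx μ)) hx μ σ))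
  rw [h, blk21_block3] at hT
  rw [Omega₀, conj, h, hT, u, Matrix.mul_inv_rev, u₁, u₀, inversion_inv, middle_inv he]
  simp only [inversion, middle, block3_mul, blk21_block3, blk22_block3]
  simp [Matrix.mul_assoc]

theorem ricciContraction_Omega₀ (hU : IsOpen U) (hϖ : IsCartanConnection U ϖ)
    (hN : IsNormal U ϖ) (hx : x ∈ U) :
    ricciContraction (fun y μ σ => blk22 (Omega₀ ϖ y μ σ)) x = 0 := by
  have he := hϖ.soldering x hx
  set F := fun μ σ => blk22 (curvature ϖ x μ σ) with hF
  -- The contraction of `F` with its last index kept as a coordinate index: the frame version is `G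
  -- e⁻¹`, the coordinate version `eᵀ G`.
  let G : Matrix (Fin m) (Fin m) ℝ := of fun b σ => ∑ a, ∑ μ, F μ σ a b * (vielbein ϖ x)⁻¹ μ a
  have hG : G * (vielbein ϖ x)⁻¹ = 0 := by
    rw [← hN.2 x hx]
    ext b c
    simp only [G, ricciFrame, mul_apply, of_apply, Finset.sum_mul]
    rw [Finset.sum_comm]
    refine Finset.sum_congr rfl fun a _ => ?_
    rw [Finset.sum_comm]
  have hG0 : G = 0 := by
    rw [← nonsing_inv_mul_cancel_right _ G he, hG, Matrix.zero_mul]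
  have : ricciContraction (fun y μ σ => blk22 (Omega₀ ϖ y μ σ)) x
      = (vielbein ϖ x).transpose * G := by
    ext ν σ
    simp only [ricciContraction, of_apply,
      fun ρ σ => (Omega₀_of_torsion_eq_zero hU hϖ hx (hN.1 x hx ρ σ)).2]
    simp only [G, mul_apply, of_apply, transpose_apply, Finset.mul_sum, Finset.sum_mul]
    rw [Finset.sum_comm]
    refine Finset.sum_congr rfl fun b _ => ?_
    rw [Finset.sum_comm]
    refine Finset.sum_congr rfl fun a _ => Finset.sum_congr rfl fun μ _ => ?_
    simp only [hF]
    ring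
  rw [this, hG0, Matrix.mul_zero]

theorem mul_dx_apply {κ : Type} (B : Matrix κ (Fin m) ℝ) (μ : Fin m) (ρ : κ) :
    (B * dx x μ) ρ () = B ρ μ := by
  simp [mul_apply, dx]

theorem dx_mul_apply {κ : Type} (P : Matrix Unit κ ℝ) (μ ρ : Fin m) (ν : κ) :
    (dx x μ * P) ρ ν = (1 : Matrix (Fin m) (Fin m) ℝ) ρ μ * P () ν := by
  simp [mul_apply, dx, one_apply]

theorem mul_dxT_mul_apply (g : Matrix (Fin m) (Fin m) ℝ) (B : Matrix (Fin m) Unit ℝ)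
    (σ ρ ν : Fin m) : (B * ((dx x σ).transpose * g)) ρ ν = B ρ () * g σ ν := by
  simp [mul_apply, dx]

/-- Uniqueness of the Levi-Civita connection. -/
theorem eq_leviCivita {Γ : OneForm m (Fin m) (Fin m)} {g : ZeroForm m (Fin m) (Fin m)}
    (hgs : (g x).transpose = g x) (hgu : IsUnit (g x).det)
    (hΓ : ∀ μ σ ρ, Γ x μ ρ σ = Γ x σ ρ μ) (hg : ∀ μ, nablaMetric Γ g x μ = 0) (μ : Fin m) :
    Γ x μ = leviCivita g x μ := by
  have hd : ∀ a b c, pd a g x b c = (g x * Γ x a) c b + (g x * Γ x a) b c := by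
    intro a b c
    have h := hg a
    rw [nablaMetric, sub_sub, sub_eq_zero] at h
    rw [h, Matrix.add_apply]
    congr 1
    rw [← transpose_apply (g x * Γ x a), transpose_mul, hgs]
  have hs : ∀ a b c, (g x * Γ x a) b c = (g x * Γ x c) b a := by
    intro a b c
    simp only [mul_apply]
    exact Finset.sum_congr rfl fun d _ => by rw [hΓ]
  ext ρ ν
  -- Koszul's argument: in the alternating sum of derivatives of `g`, everything cancels except
  -- twice the lowered `(g Γ_μ)_{lν}`.
  conv_lhs => rw [← nonsing_inv_mul_cancel_left _ (Γ x μ) hgu, mul_apply]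
  simp only [leviCivita, of_apply, Finset.mul_sum]
  refine Finset.sum_congr rfl fun l _ => ?_
  rw [hd, hd, hd, hs l ν μ, hs l μ ν, hs ν μ l, hs ν l μ]
  ring

/-- The first Bianchi identity for a torsion-free connection. -/
theorem first_bianchi {Γ : OneForm m (Fin m) (Fin m)} (hU : IsOpen U)
    (hΓ : ∀ x ∈ U, ∀ μ σ ρ, Γ x μ ρ σ = Γ x σ ρ μ) (hx : x ∈ U) (μ σ ν ρ : Fin m) :
    curvature Γ x μ σ ρ ν + curvature Γ x σ ν ρ μ + curvature Γ x ν μ ρ σ = 0 := by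
  have hd : ∀ a b c, pd a (fun y => Γ y b) x ρ c = pd a (fun y => Γ y c) x ρ b := by
    intro a b c
    -- Single entries are viewed as `1 × 1` matrices so that `pd_congr` differentiates the symmetry
    -- of `Γ`.
    exact congrFun (congrFun (pd_congr (M := fun y => of fun _ _ : Unit => Γ y b ρ c)
      (N := fun y => of fun _ _ : Unit => Γ y c ρ b) hU hx
      (fun y hy => by ext; exact hΓ y hy b c ρ) a) ()) ()
  have hm : ∀ a b c, (Γ x a * Γ x b) ρ c = (Γ x a * Γ x c) ρ b := by
    intro a b c
    simp only [mul_apply]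
    exact Finset.sum_congr rfl fun d _ => by rw [hΓ x hx b c d]
  simp only [curvature, extd, wedge, Matrix.add_apply, Matrix.sub_apply]
  rw [hd μ σ ν, hd σ ν μ, hd ν μ σ, hm μ σ ν, hm σ ν μ, hm ν μ σ]
  ring

theorem curvature_antisymm [Fintype ι] (B : OneForm m ι ι) (μ σ : Fin m) :
    curvature B x μ σ = -curvature B x σ μ := by
  simp only [curvature, extd, wedge]
  abel

/-- The curvature of `Γ` is conjugate by `e` to that of `A₁`, which is `η`-skew. -/
theorem trace_curvature_Gam (hU : IsOpen U) (hϖ : IsCartanConnection U ϖ) (hx : x ∈ U)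
    (μ σ : Fin m) : (curvature (Gam ϖ) x μ σ).trace = 0 := by
  rw [Gam, curvature_act hU hx (hϖ.smooth_A₁ hU) hϖ.smooth_vielbein hϖ.soldering, conj,
    trace_mul_comm, mul_nonsing_inv_cancel_left _ _ (hϖ.soldering x hx)]
  exact trace_eq_zero_of_skew_eta (curvature_skew hU (hϖ.smooth_A₁ hU)
    (fun y hy κ => (varpi₁_eq_block3 hU hϖ hy κ).1) hx μ σ)

/-- The Ricci tensor of a torsion-free connection with traceless curvature is symmetric. -/
theorem ricciContraction_symm {Γ : OneForm m (Fin m) (Fin m)} (hU : IsOpen U)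
    (hΓ : ∀ x ∈ U, ∀ μ σ ρ, Γ x μ ρ σ = Γ x σ ρ μ) (hx : x ∈ U)
    (htr : ∀ μ σ, (curvature Γ x μ σ).trace = 0) (ν σ : Fin m) :
    ricciContraction (curvature Γ) x ν σ = ricciContraction (curvature Γ) x σ ν := by
  -- The Bianchi identity contracted over `ρ`; its middle term is a trace of the curvature.
  have h : ∑ ρ, (curvature Γ x ρ σ ρ ν + curvature Γ x σ ν ρ ρ + curvature Γ x ν ρ ρ σ) = 0 :=
    Finset.sum_eq_zero fun ρ _ => first_bianchi hU hΓ hx ρ σ ν ρ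
  have h2 : ∑ ρ, curvature Γ x σ ν ρ ρ = 0 := htr σ ν
  rw [Finset.sum_add_distrib, Finset.sum_add_distrib, h2, add_zero] at h
  simp only [ricciContraction, of_apply]
  simp only [fun ρ => curvature_antisymm (x := x) Γ ν ρ, Matrix.neg_apply,
    Finset.sum_neg_distrib] at h
  linarith

/-- `∇g⁻¹ = -g⁻¹ (∇g) g⁻¹`. -/
theorem nablaInvMetric_eq_zero {Γ : OneForm m (Fin m) (Fin m)} {g : ZeroForm m (Fin m) (Fin m)}
    (hU : IsOpen U) (hgs : Smooth₀ U g) (hgu : ∀ x ∈ U, IsUnit (g x).det) (hx : x ∈ U)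
    {μ : Fin m} (hg : nablaMetric Γ g x μ = 0) : nablaInvMetric Γ g x μ = 0 := by
  have hu := hgu x hx
  rw [nablaMetric, sub_sub, sub_eq_zero] at hg
  rw [nablaInvMetric, pd_inv hU hx hgs hgu, hg]
  simp only [Matrix.mul_add, Matrix.add_mul, mul_nonsing_inv_cancel_right _ _ hu, Matrix.mul_assoc,
    nonsing_inv_mul_cancel_left _ _ hu]
  abel

/-- The algebraic equation which determines the Schouten tensor from the Ricci tensor. -/
theorem schouten_of_ricci_eq (hm : 3 ≤ m) {g Ric p : Matrix (Fin m) (Fin m) ℝ}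
    (hgs : g.transpose = g) (hgu : IsUnit g.det) (hR : Ric.transpose = Ric)
    (h : ∀ ν σ, Ric ν σ + ((m : ℝ) - 2) * p σ ν + (∑ ρ, ∑ l, g⁻¹ ρ l * p ρ l) * g σ ν = 0) :
    p = (-1 / ((m : ℝ) - 2)) •
      (Ric - ((∑ ν, ∑ σ, g⁻¹ ν σ * Ric ν σ) / (2 * ((m : ℝ) - 1))) • g) := by
  have hm' : (3 : ℝ) ≤ m := by exact_mod_cast hm
  have h2 : (m : ℝ) - 2 ≠ 0 := by linarith
  have h1 : (m : ℝ) - 1 ≠ 0 := by linarith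
  set t := ∑ ρ, ∑ l, g⁻¹ ρ l * p ρ l with ht
  set s := ∑ ν, ∑ σ, g⁻¹ ν σ * Ric ν σ with hs
  have hgi : ∀ a b, g⁻¹ a b = g⁻¹ b a := fun a b => by
    rw [← transpose_apply g⁻¹, transpose_nonsing_inv, hgs]
  have htg : ∑ ν, ∑ σ, g⁻¹ ν σ * g σ ν = m := by
    have : (g⁻¹ * g).trace = m := by rw [nonsing_inv_mul _ hgu, trace_one, Fintype.card_fin]
    simpa [trace, mul_apply] using this
  have htp : ∑ ν, ∑ σ, g⁻¹ ν σ * p σ ν = t := by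
    rw [ht, Finset.sum_comm]
    exact Finset.sum_congr rfl fun a _ => Finset.sum_congr rfl fun b _ => by rw [hgi]
  -- Tracing the equation with `g⁻¹` gives `s + 2(m-1) t = 0`, which eliminates the unknown trace
  -- `t` of `p`.
  have hsum : s + ((m : ℝ) - 2) * t + t * m = 0 := by
    have h0 : ∑ ν, ∑ σ, g⁻¹ ν σ * (Ric ν σ + ((m : ℝ) - 2) * p σ ν + t * g σ ν) = 0 :=
      Finset.sum_eq_zero fun ν _ => Finset.sum_eq_zero fun σ _ => by rw [h, mul_zero]
    have hl : ∀ (c : ℝ) (w : Matrix (Fin m) (Fin m) ℝ),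
        ∑ ν, ∑ σ, g⁻¹ ν σ * (c * w σ ν) = c * ∑ ν, ∑ σ, g⁻¹ ν σ * w σ ν := fun c w => by
      simp only [Finset.mul_sum, mul_left_comm]
    simpa only [mul_add, Finset.sum_add_distrib, hl, htp, htg] using h0
  have hts : t = -(s / (2 * ((m : ℝ) - 1))) := by
    field_simp
    linear_combination hsum
  ext σ ν
  have hσ := h ν σ
  -- Symmetry of `p` is not assumed: it comes out of the symmetry of `Ric` and `g`.
  rw [← transpose_apply Ric, hR] at hσ
  simp only [Matrix.smul_apply, Matrix.sub_apply, smul_eq_mul]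
  rw [show s / (2 * ((m : ℝ) - 1)) = -t by rw [hts, neg_neg]]
  field_simp
  linear_combination hσ

theorem normal_dressed (hm : 3 ≤ m) (hU : IsOpen U) (hϖ : IsCartanConnection U ϖ)
    (hN : IsNormal U ϖ) :
    (∀ x ∈ U, ∀ μ σ, wedge (Gam ϖ) dx x μ σ = 0) ∧
    (∀ x ∈ U, ∀ μ σ ρ, Gam ϖ x μ ρ σ = Gam ϖ x σ ρ μ) ∧
    (∀ x ∈ U, ∀ μ, Gam ϖ x μ = leviCivita (metric ϖ) x μ) ∧
    (∀ x ∈ U, ∀ μ σ, riemann (metric ϖ) x μ σ = curvature (Gam ϖ) x μ σ) ∧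
    (∀ x ∈ U, (ricci (metric ϖ) x).transpose = ricci (metric ϖ) x) ∧
    (∀ x ∈ U, ∀ μ ν, Pf ϖ x μ () ν = schouten (metric ϖ) x μ ν) := by
  have hT : ∀ x ∈ U, ∀ μ σ, wedge (Gam ϖ) dx x μ σ = 0 := fun x hx μ σ => by
    have := (Omega₀_of_torsion_eq_zero hU hϖ hx (hN.1 x hx μ σ)).1
    rwa [Omega₀_eq_block3 hU hϖ hx, blk21_block3] at this
  have hΓ : ∀ x ∈ U, ∀ μ σ ρ, Gam ϖ x μ ρ σ = Gam ϖ x σ ρ μ := fun x hx μ σ ρ => by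
    have := congrFun (congrFun (hT x hx μ σ) ρ) ()
    simp only [wedge, Matrix.sub_apply, mul_dx_apply, Matrix.zero_apply] at this
    linarith
  have hLC : ∀ x ∈ U, ∀ μ, Gam ϖ x μ = leviCivita (metric ϖ) x μ := fun x hx =>
    eq_leviCivita metric_transpose (hϖ.isUnit_det_metric hx) (hΓ x hx)
      (nablaMetric_Gam hU hϖ hx)
  have hRiem : ∀ x ∈ U, ∀ μ σ, riemann (metric ϖ) x μ σ = curvature (Gam ϖ) x μ σ :=
    fun x hx μ σ => (curvature_congr hU hx hLC μ σ).symm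
  have hRic : ∀ x ∈ U, ricci (metric ϖ) x = ricciContraction (curvature (Gam ϖ)) x :=
    fun x hx => by
      ext ν σ
      simp only [ricci, ricciContraction, of_apply, hRiem x hx]
  have hRicS : ∀ x ∈ U, (ricci (metric ϖ) x).transpose = ricci (metric ϖ) x := fun x hx => by
    ext ν σ
    rw [transpose_apply, hRic x hx]
    exact ricciContraction_symm hU hΓ hx (trace_curvature_Gam hU hϖ hx) σ ν
  refine ⟨hT, hΓ, hLC, hRiem, hRicS, fun x hx μ ν => ?_⟩
  have hgu := hϖ.isUnit_det_metric hx
  have key := schouten_of_ricci_eq (p := of fun μ ν => Pf ϖ x μ () ν) hm metric_transpose hgu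
    (hRicS x hx) fun ν σ => ?_
  · have := congrFun (congrFun key μ) ν
    rw [of_apply] at this
    rw [this]
    rfl
  · have h0 := congrFun (congrFun (ricciContraction_Omega₀ hU hϖ hN hx) ν) σ
    simp only [ricciContraction, of_apply, Omega₀_eq_block3 hU hϖ hx, blk22_block3, wedge, formT,
      Matrix.add_apply, Matrix.sub_apply, dx_mul_apply, mul_dxT_mul_apply, Matrix.zero_apply,
      Finset.sum_add_distrib, Finset.sum_sub_distrib, one_apply_eq] at h0
    -- The four sums from the two wedge terms contribute `m P`, `-P`, `-P` and `(tr P) g`, whence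
    -- the factor `m - 2`.
    have e1 : ∑ ρ : Fin m, 1 * Pf ϖ x σ () ν = m * Pf ϖ x σ () ν := by simp
    have e2 : ∑ ρ, (1 : Matrix (Fin m) (Fin m) ℝ) ρ σ * Pf ϖ x ρ () ν = Pf ϖ x σ () ν := by
      simp [one_apply]
    have e3 : ∑ ρ, ((metric ϖ x)⁻¹ * (Pf ϖ x σ).transpose) ρ () * metric ϖ x ρ ν
        = Pf ϖ x σ () ν := by
      have : ((((metric ϖ x)⁻¹ * (Pf ϖ x σ).transpose).transpose * metric ϖ x) : Matrix _ _ ℝ)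
          = Pf ϖ x σ := by
        rw [transpose_mul, transpose_transpose, inv_metric_transpose,
          nonsing_inv_mul_cancel_right _ _ hgu]
      rw [← congrFun (congrFun this ()) ν, mul_apply]
      rfl
    have e4 : ∑ ρ, ((metric ϖ x)⁻¹ * (Pf ϖ x ρ).transpose) ρ () * metric ϖ x σ ν
        = (∑ ρ, ∑ l, (metric ϖ x)⁻¹ ρ l * Pf ϖ x ρ () l) * metric ϖ x σ ν := by
      rw [Finset.sum_mul]
      rfl
    have e0 : ricci (metric ϖ) x ν σ = ∑ ρ, curvature (Gam ϖ) x ρ σ ρ ν := by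
      rw [hRic x hx]
      rfl
    rw [e1, e2, e3, e4, ← e0] at h0
    simp only [of_apply]
    linarith

/-! ### Cotton and Weyl tensors in the normal dressed curvature. -/

theorem extd_Pf_eq_cotton (hm : 3 ≤ m) (hU : IsOpen U) (hϖ : IsCartanConnection U ϖ)
    (hN : IsNormal U ϖ) (hx : x ∈ U) (μ σ : Fin m) :
    extd (Pf ϖ) x μ σ + wedge (Pf ϖ) (Gam ϖ) x μ σ = cotton (metric ϖ) x μ σ := by
  obtain ⟨-, hΓ, hLC, -, -, hP⟩ := normal_dressed hm hU hϖ hN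
  have hpd : ∀ a b c, pd a (fun y => Pf ϖ y b) x () c = pd a (schouten (metric ϖ)) x b c := by
    intro a b c
    exact congrFun (congrFun (pd_congr (M := fun y => of fun _ _ : Unit => Pf ϖ y b () c)
      (N := fun y => of fun _ _ : Unit => schouten (metric ϖ) y b c) hU hx
      (fun y hy => by ext; exact hP y hy b c) a) ()) ()
  ext i ν
  simp only [extd, wedge, cotton, covDeriv, of_apply, Matrix.add_apply, Matrix.sub_apply, hpd,
    mul_apply, ← hLC x hx, hP x hx]
  -- The terms with `Γ^l_{μσ}` cancel by symmetry; the other Christoffel terms are `P ∧ Γ`.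
  simp only [fun l => hΓ x hx σ μ l, mul_comm (Gam ϖ x _ _ _)]
  ring

theorem blk22_Omega₀_eq_weylTensor (hm : 3 ≤ m) (hU : IsOpen U) (hϖ : IsCartanConnection U ϖ)
    (hN : IsNormal U ϖ) (hx : x ∈ U) (μ σ : Fin m) :
    blk22 (Omega₀ ϖ x μ σ) = weylTensor (metric ϖ) x μ σ := by
  obtain ⟨-, -, -, hRiem, hRicS, hP⟩ := normal_dressed hm hU hϖ hN
  have hm' : (3 : ℝ) ≤ m := by exact_mod_cast hm
  have h2 : (m : ℝ) - 2 ≠ 0 := by linarith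
  have h1 : (m : ℝ) - 1 ≠ 0 := by linarith
  have hgu := hϖ.isUnit_det_metric hx
  have hg : ∀ a b, metric ϖ x a b = metric ϖ x b a := fun a b => by
    rw [← transpose_apply (metric ϖ x), metric_transpose]
  have hR : ∀ a b, ricci (metric ϖ) x a b = ricci (metric ϖ) x b a := fun a b => by
    rw [← transpose_apply (ricci (metric ϖ) x), hRicS x hx]
  have hS : schouten (metric ϖ) x = (-1 / ((m : ℝ) - 2)) • (ricci (metric ϖ) x -
      (scalarCurv (metric ϖ) x / (2 * ((m : ℝ) - 1))) • metric ϖ x) := rfl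
  -- Raising an index of the Schouten tensor turns its `g` term into `δ`. The scalar terms of the
  -- two wedges add up, absorbing the `2` in `2(m-1)`.
  have hup : ∀ κ ρ, ((metric ϖ x)⁻¹ * (Pf ϖ x κ).transpose) ρ () = -1 / ((m : ℝ) - 2) *
      (((metric ϖ x)⁻¹ * ricci (metric ϖ) x) ρ κ - scalarCurv (metric ϖ) x / (2 * ((m : ℝ) - 1)) *
        (1 : Matrix (Fin m) (Fin m) ℝ) ρ κ) := by
    intro κ ρ
    have : ((metric ϖ x)⁻¹ * (Pf ϖ x κ).transpose) ρ () =
        ((metric ϖ x)⁻¹ * schouten (metric ϖ) x) ρ κ := by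
      simp only [mul_apply, transpose_apply, hP x hx]
      refine Finset.sum_congr rfl fun l _ => ?_
      simp only [schouten, of_apply]
      rw [hg, hR]
    rw [this, hS, Matrix.mul_smul, Matrix.mul_sub, Matrix.mul_smul, nonsing_inv_mul _ hgu]
    rfl
  rw [Omega₀_eq_block3 hU hϖ hx, blk22_block3]
  ext ρ ν
  simp only [wedge, formT, Matrix.add_apply, Matrix.sub_apply, dx_mul_apply, mul_dxT_mul_apply,
    weylTensor, of_apply, hRiem x hx, hup, hP x hx, schouten]
  rw [hR σ ν, hR μ ν, hg σ ν, hg μ ν]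
  field_simp
  ring

theorem Omega₀_normal (hm : 3 ≤ m) (hU : IsOpen U) (hϖ : IsCartanConnection U ϖ)
    (hN : IsNormal U ϖ) (hx : x ∈ U) (μ σ : Fin m) : Omega₀ ϖ x μ σ =
      block3 0 (cotton (metric ϖ) x μ σ) 0
        0 (weylTensor (metric ϖ) x μ σ) ((metric ϖ x)⁻¹ * (cotton (metric ϖ) x μ σ).transpose)
        0 0 0 := by
  obtain ⟨hT, hΓ, -, -, hRicS, hP⟩ := normal_dressed hm hU hϖ hN
  have hPs : Pf ϖ x μ () σ = Pf ϖ x σ () μ := by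
    rw [hP x hx, hP x hx]
    simp only [schouten, of_apply]
    rw [← transpose_apply (metric ϖ x), metric_transpose, ← transpose_apply (ricci (metric ϖ) x),
      hRicS x hx]
  have h11 : Pf ϖ x μ * dx x σ = Pf ϖ x σ * dx x μ := by
    ext i j
    rw [mul_dx_apply, mul_dx_apply, hPs]
  have hΓs : Gam ϖ x σ * dx x μ = Gam ϖ x μ * dx x σ := by
    ext i j
    rw [mul_dx_apply, mul_dx_apply, hΓ x hx]
  have h22 := blk22_Omega₀_eq_weylTensor hm hU hϖ hN hx μ σ
  have hinv : ∀ κ, nablaInvMetric (Gam ϖ) (metric ϖ) x κ = 0 := fun κ =>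
    nablaInvMetric_eq_zero hU hϖ.smooth_metric (fun y hy => hϖ.isUnit_det_metric hy) hx
      (nablaMetric_Gam hU hϖ hx κ)
  rw [Omega₀_eq_block3 hU hϖ hx, blk22_block3] at h22
  rw [Omega₀_eq_block3 hU hϖ hx, extd_Pf_eq_cotton hm hU hϖ hN hx, h22, hT x hx, block3_inj]
  refine ⟨?_, rfl, rfl, rfl, rfl, ?_, rfl, ?_, ?_⟩
  · rw [wedge, h11, sub_self]
  · simp [wedge, hinv]
  · simp only [wedge, formT, nablaMetric_Gam hU hϖ hx, zero_add, ← Matrix.mul_assoc,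
      ← transpose_mul, hΓs, sub_self, neg_zero]
  · simp only [wedge, formT, ← transpose_mul, h11, sub_self]

end Normal

end ConformalCartan
theorem mainTheorem3 (m : ℕ) (hm : 3 ≤ m) (U : Set (ConformalCartan.Space m)) (hU : IsOpen U)
    (ϖ : ConformalCartan.OneForm m (ConformalCartan.Idx m) (ConformalCartan.Idx m))
    (hϖ : ConformalCartan.IsCartanConnection U ϖ) :
    open ConformalCartan in
    -- `SO · K₁` is a subgroup of `H`, and its gauge group acts on Cartan connections
    (IsMatrixGroup (groupSOK₁ m) ∧ groupSOK₁ m ⊆ groupH m ∧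
      ∀ γ, IsGauge U (groupSOK₁ m) γ → IsCartanConnection U (act ϖ γ)) ∧
    -- the two dressing fields and their compatibility conditions
    (IsGauge U (groupK₁ m) (u₁ ϖ) ∧
      IsDressingField U (groupK₁ m) u₁ ϖ ∧
      IsDressingField U (groupSO m) u₀ ϖ ∧
      (∀ S, IsGauge U (groupSO m) S → ∀ x ∈ U, u₁ (act ϖ S) x = (S x)⁻¹ * u₁ ϖ x * S x) ∧
      (∀ γ, IsGauge U (groupK₁ m) γ → ∀ x ∈ U, u₀ (act ϖ γ) x = u₀ ϖ x)) ∧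
    -- `u = u₁ u₀` is a dressing field for `SO · K₁`
    IsDressingField U (groupSOK₁ m) u ϖ ∧
    -- the composite fields are invariant, and can be obtained in one or in two steps
    (∀ γ, IsGauge U (groupSOK₁ m) γ → ∀ x ∈ U,
      (∀ μ, varpi₀ (act ϖ γ) x μ = varpi₀ ϖ x μ) ∧
      ∀ μ σ, Omega₀ (act ϖ γ) x μ σ = Omega₀ ϖ x μ σ) ∧
    (∀ x ∈ U, ∀ μ, varpi₀ ϖ x μ = act (varpi₁ ϖ) (u₀ ϖ) x μ) ∧
    (∀ x ∈ U, ∀ μ σ, Omega₀ ϖ x μ σ = conj (conj (curvature ϖ) (u₁ ϖ)) (u₀ ϖ) x μ σ ∧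
      Omega₀ ϖ x μ σ = curvature (varpi₀ ϖ) x μ σ) ∧
    -- the dressed connection in terms of `dx`, `Γ`, `g`, `P`
    (∀ x ∈ U, ∀ μ, varpi₀ ϖ x μ =
      block3 0 (Pf ϖ x μ) 0
        (dx x μ) (Gam ϖ x μ) ((metric ϖ x)⁻¹ * (Pf ϖ x μ).transpose)
        0 ((dx x μ).transpose * metric ϖ x) 0) ∧
    -- `g` is a smooth nondegenerate metric, `P` and `Γ` are smooth, and `Γ` is metric-compatible
    (Smooth₀ U (metric ϖ) ∧ Smooth₁ U (Gam ϖ) ∧ Smooth₁ U (Pf ϖ) ∧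
      ∀ x ∈ U, (metric ϖ x).IsSymm ∧ IsUnit (metric ϖ x).det ∧
        (∀ μ, nablaMetric (Gam ϖ) (metric ϖ) x μ = 0)) ∧
    -- under coordinate changes `g` and `P` are tensors and `Γ` is a linear connection
    (∀ V φ, IsCoordChange V U φ → IsCartanConnection V (pullback φ ϖ) ∧
      ∀ y ∈ V,
        metric (pullback φ ϖ) y = (jac φ y).transpose * metric ϖ (φ y) * jac φ y ∧
        ∀ ν, Pf (pullback φ ϖ) y ν = pullback φ (Pf ϖ) y ν * jac φ y ∧
          Gam (pullback φ ϖ) y ν =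
            (jac φ y)⁻¹ * pullback φ (Gam ϖ) y ν * jac φ y + (jac φ y)⁻¹ * pd ν (jac φ) y) ∧
    -- the dressed curvature
    (∀ x ∈ U, ∀ μ σ, Omega₀ ϖ x μ σ =
      block3 (wedge (Pf ϖ) dx x μ σ) (extd (Pf ϖ) x μ σ + wedge (Pf ϖ) (Gam ϖ) x μ σ) 0
        (wedge (Gam ϖ) dx x μ σ)
        (curvature (Gam ϖ) x μ σ + wedge dx (Pf ϖ) x μ σ
          + wedge (fun y κ => (metric ϖ y)⁻¹ * formT (Pf ϖ) y κ)
              (fun y κ => formT dx y κ * metric ϖ y) x μ σ)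
        (wedge (nablaInvMetric (Gam ϖ) (metric ϖ)) (formT (Pf ϖ)) x μ σ
          + (metric ϖ x)⁻¹ * (extd (Pf ϖ) x μ σ + wedge (Pf ϖ) (Gam ϖ) x μ σ).transpose)
        0
        (-wedge (formT dx)
          (fun y κ => nablaMetric (Gam ϖ) (metric ϖ) y κ + formT (Gam ϖ) y κ * metric ϖ y) x μ σ)
        (wedge (formT dx) (formT (Pf ϖ)) x μ σ)) ∧
    -- the normal case
    (IsNormal U ϖ → ∀ x ∈ U,
      (∀ μ, Gam ϖ x μ = leviCivita (metric ϖ) x μ) ∧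
      (∀ μ ν, Pf ϖ x μ () ν = schouten (metric ϖ) x μ ν) ∧
      (∀ μ ν, Pf ϖ x μ () ν = Pf ϖ x ν () μ) ∧
      (∀ μ σ, wedge (Gam ϖ) dx x μ σ = 0) ∧
      ricciContraction (fun y μ σ => blk22 (Omega₀ ϖ y μ σ)) x = 0 ∧
      ∀ μ σ, Omega₀ ϖ x μ σ =
        block3 0 (cotton (metric ϖ) x μ σ) 0
          0 (weylTensor (metric ϖ) x μ σ)
            ((metric ϖ x)⁻¹ * (cotton (metric ϖ) x μ σ).transpose)
          0 0 0) := by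
  refine ⟨⟨ConformalCartan.isMatrixGroup_groupSOK₁, ConformalCartan.groupSOK₁_subset_groupH,
      fun γ hγ => hϖ.act hU hγ⟩,
    ⟨hϖ.isGauge_u₁, hϖ.isDressingField_u₁ hU, hϖ.isDressingField_u₀ hU,
      fun S hS x hx => ConformalCartan.u₁_act_SO hU hϖ hS hx,
      fun γ hγ x hx => ConformalCartan.u₀_act_K₁ hU hϖ hγ hx⟩,
    hϖ.isDressingField_u hU,
    fun γ hγ x hx => ⟨ConformalCartan.varpi₀_act hU hϖ hγ hx,
      ConformalCartan.Omega₀_act hU hϖ hγ hx⟩,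
    fun x hx => ConformalCartan.varpi₀_eq_act_varpi₁ hU hϖ hx,
    fun x hx μ σ => ⟨ConformalCartan.conj_mul _ _ _ μ σ,
      ConformalCartan.Omega₀_eq_curvature hU hϖ hx μ σ⟩,
    fun x hx => ConformalCartan.varpi₀_eq_block3 hU hϖ hx,
    ⟨hϖ.smooth_metric, hϖ.smooth_Gam hU, hϖ.smooth_Pf hU,
      fun x hx => ⟨ConformalCartan.metric_transpose, hϖ.isUnit_det_metric hx,
        ConformalCartan.nablaMetric_Gam hU hϖ hx⟩⟩,
    fun V φ hφ => ⟨hϖ.pullback hφ, fun y hy => ⟨ConformalCartan.metric_pullback,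
      fun ν => ⟨ConformalCartan.Pf_pullback hU hϖ hφ hy ν,
        ConformalCartan.Gam_pullback hU hϖ hφ hy ν⟩⟩⟩,
    fun x hx => ConformalCartan.Omega₀_eq_block3 hU hϖ hx,
    fun hN x hx => ?_⟩
  obtain ⟨hT, -, hLC, -, hRicS, hP⟩ := ConformalCartan.normal_dressed hm hU hϖ hN
  refine ⟨hLC x hx, hP x hx, fun μ ν => ?_, hT x hx,
    ConformalCartan.ricciContraction_Omega₀ hU hϖ hN hx,
    ConformalCartan.Omega₀_normal hm hU hϖ hN hx⟩
  rw [hP x hx, hP x hx]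
  simp only [ConformalCartan.schouten, Matrix.of_apply]
  rw [← Matrix.transpose_apply (ConformalCartan.metric ϖ x), ConformalCartan.metric_transpose,
    ← Matrix.transpose_apply (ConformalCartan.ricci (ConformalCartan.metric ϖ) x), hRicS x hx]
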